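/- Work with (strict) 2-categories, i.e. $\mathbf{Cat}$-enriched categories, where $\mathbf{Cat}$ is the 2-category of small categories. For 2-functors $F,G:\mathcal J\to\mathcal K$, let $\mathrm{Ps}(\mathcal J,\mathcal K)(F,G)$ be the category of pseudonatural transformations and modifications, and $[\mathcal J,\mathcal K](F,G)$ its full subcategory on the (strictly) 2-natural transformations. A weight is a 2-functor $W:\mathcal J\to\mathbf{Cat}$ with $\mathcal J$ a small 2-category. For a diagram (2-functor) $D:\mathcal J^{\mathrm{op}}\to\mathcal C$, the colimit $W\star D$ is an object of $\mathcal C$ with a 2-natural cocone $\varphi:W\to\mathcal C(D-,W\star D)$ for which $u\mapsto \mathcal C(D-,u)\circ\varphi$ is an isomorphism of categories $\mathcal C(W\star D,A)\cong[\mathcal J,\mathbf{Cat}](W,\mathcal C(D-,A))$ for all $A\in\mathcal C$; weighted limits are defined dually. $\mathcal C$ is complete and cocomplete if it has all limits and colimits weighted by weights on small 2-categories. The pseudomorphism classifier of $W$ is the 2-functor $QW:\mathcal J\to\mathbf{Cat}$ with a pseudonatural transformation $p_W:W\to QW$ such that composition with $p_W$ is an isomorphism of categories $[\mathcal J,\mathbf{Cat}](QW,X)\cong\mathrm{Ps}(\mathcal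 J,\mathbf{Cat})(W,X)$ for every 2-functor $X:\mathcal J\to\mathbf{Cat}$; it always exists. Let $q_W:QW\to W$ be the unique 2-natural transformation with $q_W\circ p_W=1_W$, and write $q_W\star D:QW\star D\to W\star D$ for the induced 1-cell between colimits. Similarly, a 2-natural transformation $f:D\to E$ of diagrams induces a 1-cell $W\star f:W\star D\to W\star E$. **Proposition.** Let $\mathcal C$ be a complete and cocomplete 2-category and let $W:\mathcal J\to\mathbf{Cat}$ be a weight on a small 2-category $\mathcal J$. The following are equivalent. 1. $W$-colimits are bicolimits in $\mathcal C$: for every diagram $D:\mathcal J^{\mathrm{op}}\to\mathcal C$ and every $A\in\mathcal C$, the functor $\mathcal C(W\star D,A)\to\mathrm{Ps}(\mathcal J,\mathbf{Cat})(W,\mathcal C(D-,A))$ given by composition with the colimiting cocone is an equivalence of categories. 2. For every diagram $D:\mathcal J^{\mathrm{op}}\to\mathcal C$, the 1-cell $q_W\star D:QW\star D\to W\star D$ is an equivalence in $\mathcal C$. 3. For every 2-natural transformation $f:D\to E$ between diagrams $\mathcal J^{\mathrm{op}}\to\mathcal C$ each of whose components $f_j:Dj\to Ej$ is an equivalence in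 $\mathcal C$, the 1-cell $W\star f:W\star D\to W\star E$ is an equivalence in $\mathcal C$. -/

import Mathlib

open CategoryTheory Bicategory Opposite Bicategory.Opposite
open scoped Pseudofunctor.StrongTrans

universe w₁ w₂ v₁ v₂ u₁ u₂ u v

namespace TwoCat

section Auxiliary

lemma eqToHom_chain {X : Type u₁} [Category.{v₁} X] {a b c d e f : X} (h₁ : a = b) (h₂ : b = c)
    (h₃ : c = d) (h₄ : d = e) (h₅ : e = f) (h : a = f) :
    eqToHom h₁ ≫ eqToHom h₂ ≫ eqToHom h₃ ≫ eqToHom h₄ ≫ eqToHom h₅ = eqToHom h := by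
  simp

lemma eqToHom_conj_trans {X : Type u₁} [Category.{v₁} X] {a b c d e : X} (h₁ : a = b)
    (m : b ⟶ c) (h₂ : c = d) (h₃ : d = e) (h₁' : a = b) (h₄ : c = e) :
    eqToHom h₁ ≫ m ≫ eqToHom h₂ ≫ eqToHom h₃ = eqToHom h₁' ≫ m ≫ eqToHom h₄ := by
  simp

variable {C : Type u₂} [Bicategory.{w₂, v₂} C] [Bicategory.Strict C]

lemma id_whiskerLeft_eq {a b : C} {f g : a ⟶ b} (m : f ⟶ g) :
    𝟙 a ◁ m = eqToHom (Strict.id_comp f) ≫ m ≫ eqToHom (Strict.id_comp g).symm := by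
  simp [Strict.leftUnitor_eqToIso]

lemma whiskerRight_id_eq {a b : C} {f g : a ⟶ b} (m : f ⟶ g) :
    m ▷ 𝟙 b = eqToHom (Strict.comp_id f) ≫ m ≫ eqToHom (Strict.comp_id g).symm := by
  simp [Strict.rightUnitor_eqToIso]

lemma comp_whiskerLeft_eq {a b c d : C} (f : a ⟶ b) (g : b ⟶ c) {x y : c ⟶ d} (m : x ⟶ y) :
    (f ≫ g) ◁ m =
      eqToHom (Strict.assoc f g x) ≫ f ◁ g ◁ m ≫ eqToHom (Strict.assoc f g y).symm := by
  simp [Strict.associator_eqToIso]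

lemma whiskerRight_comp_eq {a b c d : C} {x y : a ⟶ b} (m : x ⟶ y) (f : b ⟶ c) (g : c ⟶ d) :
    m ▷ (f ≫ g) =
      eqToHom (Strict.assoc x f g).symm ≫ m ▷ f ▷ g ≫ eqToHom (Strict.assoc y f g) := by
  simp [Strict.associator_eqToIso]

lemma whisker_assoc_eq {a b c d : C} (f : a ⟶ b) {x y : b ⟶ c} (m : x ⟶ y) (g : c ⟶ d) :
    (f ◁ m) ▷ g =
      eqToHom (Strict.assoc f x g) ≫ f ◁ m ▷ g ≫ eqToHom (Strict.assoc f y g).symm := by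
  simp [Strict.associator_eqToIso]

lemma precomposingCat_id (a b : C) :
    (precomposingCat a a b).obj (𝟙 a) = 𝟙 (Cat.of (a ⟶ b)) :=
  Cat.ext (CategoryTheory.Functor.ext (fun x => Strict.id_comp x)
    (fun _ _ m => id_whiskerLeft_eq m))

lemma precomposingCat_comp {a b c : C} (f : a ⟶ b) (g : b ⟶ c) (d : C) :
    (precomposingCat a c d).obj (f ≫ g) =
      (precomposingCat b c d).obj g ≫ (precomposingCat a b d).obj f :=
  Cat.ext (CategoryTheory.Functor.ext (fun x => Strict.assoc f g x)
    (fun _ _ m => comp_whiskerLeft_eq f g m))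

lemma postcomposingCat_id (a b : C) :
    (postcomposingCat a b b).obj (𝟙 b) = 𝟙 (Cat.of (a ⟶ b)) :=
  Cat.ext (CategoryTheory.Functor.ext (fun x => Strict.comp_id x)
    (fun _ _ m => whiskerRight_id_eq m))

lemma postcomposingCat_comp (a : C) {b c d : C} (f : b ⟶ c) (g : c ⟶ d) :
    (postcomposingCat a b d).obj (f ≫ g) =
      (postcomposingCat a b c).obj f ≫ (postcomposingCat a c d).obj g :=
  Cat.ext (CategoryTheory.Functor.ext (fun x => (Strict.assoc x f g).symm)
    (fun _ _ m => whiskerRight_comp_eq m f g))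

lemma comp_whiskerLeft_eqToHom {a b c d : C} (f : a ⟶ b) (x : b ⟶ c) {u v : c ⟶ d} (β : u ⟶ v)
    (e₁ : (f ≫ x) ≫ v = f ≫ x ≫ v) (e₂ : (f ≫ x) ≫ u = f ≫ x ≫ u) :
    (f ≫ x) ◁ β ≫ eqToHom e₁ = eqToHom e₂ ≫ f ◁ x ◁ β := by
  simp [Strict.associator_eqToIso]

lemma whiskerRight_comp_eqToHom {a b c d : C} {u v : a ⟶ b} (β : u ⟶ v) (x : b ⟶ c) (f : c ⟶ d)
    (e₁ : v ≫ x ≫ f = (v ≫ x) ≫ f) (e₂ : u ≫ x ≫ f = (u ≫ x) ≫ f) :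
    β ▷ (x ≫ f) ≫ eqToHom e₁ = eqToHom e₂ ≫ (β ▷ x) ▷ f := by
  simp [Strict.associator_eqToIso]

section

variable {B : Type u₁} [Bicategory.{w₁, v₁} B] (D : StrictPseudofunctor B C)

lemma map₂_whiskerRight_whiskerRight {a b c : B} {f g : a ⟶ b} (η : f ⟶ g) (h : b ⟶ c) {A : C}
    (x : D.obj c ⟶ A) (e₁ : D.map (f ≫ h) ≫ x = D.map f ≫ D.map h ≫ x)
    (e₂ : D.map g ≫ D.map h ≫ x = D.map (g ≫ h) ≫ x) :
    D.map₂ (η ▷ h) ▷ x = eqToHom e₁ ≫ D.map₂ η ▷ (D.map h ≫ x) ≫ eqToHom e₂ := by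
  rw [D.map₂_whisker_right, whiskerRight_comp_eq]
  simp [D.mapComp_eq_eqToIso]

lemma map₂_whiskerLeft_whiskerRight {a b c : B} (h : a ⟶ b) {f g : b ⟶ c} (η : f ⟶ g) {A : C}
    (x : D.obj c ⟶ A) (e₁ : D.map (h ≫ f) ≫ x = D.map h ≫ D.map f ≫ x)
    (e₂ : D.map h ≫ D.map g ≫ x = D.map (h ≫ g) ≫ x) :
    D.map₂ (h ◁ η) ▷ x = eqToHom e₁ ≫ D.map h ◁ (D.map₂ η ▷ x) ≫ eqToHom e₂ := by
  rw [D.map₂_whisker_left, comp_whiskerRight, comp_whiskerRight, whisker_assoc_eq]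
  simp [D.mapComp_eq_eqToIso]

lemma whiskerLeft_map₂_whiskerLeft {a b c : B} (h : a ⟶ b) {f g : b ⟶ c} (η : f ⟶ g) {A : C}
    (x : A ⟶ D.obj a) (e₁ : x ≫ D.map (h ≫ f) = (x ≫ D.map h) ≫ D.map f)
    (e₂ : (x ≫ D.map h) ≫ D.map g = x ≫ D.map (h ≫ g)) :
    x ◁ D.map₂ (h ◁ η) = eqToHom e₁ ≫ (x ≫ D.map h) ◁ D.map₂ η ≫ eqToHom e₂ := by
  rw [D.map₂_whisker_left, comp_whiskerLeft_eq]
  simp [D.mapComp_eq_eqToIso]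

lemma whiskerLeft_map₂_whiskerRight {a b c : B} {f g : a ⟶ b} (η : f ⟶ g) (h : b ⟶ c) {A : C}
    (x : A ⟶ D.obj a) (e₁ : x ≫ D.map (f ≫ h) = (x ≫ D.map f) ≫ D.map h)
    (e₂ : (x ≫ D.map g) ≫ D.map h = x ≫ D.map (g ≫ h)) :
    x ◁ D.map₂ (η ▷ h) = eqToHom e₁ ≫ (x ◁ D.map₂ η) ▷ D.map h ≫ eqToHom e₂ := by
  rw [D.map₂_whisker_right, whisker_assoc_eq]
  simp [D.mapComp_eq_eqToIso]

end

lemma cat_hom₂_ext {X Y : Cat.{v₁, u₁}} {F G : X ⟶ Y} {α β : F ⟶ G}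
    (h : ∀ x, α.toNatTrans.app x = β.toNatTrans.app x) : α = β :=
  Cat.Hom₂.ext (NatTrans.ext (funext h))

lemma comp_eqToHom_app {X Y : Cat.{v₁, u₁}} {F G G' : X ⟶ Y} (α : F ⟶ G) (h : G = G') (x : X) :
    (α ≫ eqToHom h).toNatTrans.app x =
      α.toNatTrans.app x ≫ eqToHom congr(($h).toFunctor.obj x) := by
  subst h
  simp

lemma eqToHom_comp_app {X Y : Cat.{v₁, u₁}} {F F' G : X ⟶ Y} (h : F = F') (α : F' ⟶ G) (x : X) :
    (eqToHom h ≫ α).toNatTrans.app x =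
      eqToHom congr(($h).toFunctor.obj x) ≫ α.toNatTrans.app x := by
  subst h
  simp

lemma conj_app {X Y : Cat.{v₁, u₁}} {F F' G G' : X ⟶ Y} (h : F = F') (h' : G' = G)
    (α : F' ⟶ G') (x : X) : (eqToHom h ≫ α ≫ eqToHom h').toNatTrans.app x =
      eqToHom congr(($h).toFunctor.obj x) ≫ α.toNatTrans.app x ≫
        eqToHom congr(($h').toFunctor.obj x) := by
  subst h h'
  simp

end Auxiliary

section Transformations

variable {B : Type u₁} [Bicategory.{w₁, v₁} B] {C : Type u₂} [Bicategory.{w₂, v₂} C]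

/-- Pseudonatural transformations between 2-functors. With modifications as morphisms they form
the category `Ps(B, C)(F, G)`. -/
abbrev Ps (F G : StrictPseudofunctor B C) :=
  F.toPseudofunctor ⟶ G.toPseudofunctor

/-- A pseudonatural transformation is 2-natural if all its naturality squares commute strictly
and its structure 2-cells are identities. -/
def IsTwoNatural (F G : StrictPseudofunctor B C) : ObjectProperty (Ps F G) :=
  fun η => ∀ ⦃a b : B⦄ (f : a ⟶ b),
    ∃ h : F.map f ≫ η.app b = η.app a ≫ G.map f, η.naturality f = eqToIso h

/-- The category `[B, C](F, G)` of 2-natural transformations and modifications. -/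
abbrev TwoNat (F G : StrictPseudofunctor B C) := (IsTwoNatural F G).FullSubcategory

variable [Bicategory.Strict C]
lemma twoNat_whisker {F G : StrictPseudofunctor B C} (η : TwoNat F G) {a b : B} {f g : a ⟶ b}
    (α : f ⟶ g) {A : C} (x : G.obj b ⟶ A)
    (e₁ : η.obj.app a ≫ G.map f ≫ x = F.map f ≫ η.obj.app b ≫ x)
    (e₂ : F.map g ≫ η.obj.app b ≫ x = η.obj.app a ≫ G.map g ≫ x) :
    η.obj.app a ◁ (G.map₂ α ▷ x) =
      eqToHom e₁ ≫ F.map₂ α ▷ (η.obj.app b ≫ x) ≫ eqToHom e₂ := by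
  obtain ⟨hf, ef⟩ := η.property f
  obtain ⟨hg, eg⟩ := η.property g
  have h := η.obj.naturality_naturality α
  rw [ef, eg] at h
  have h' : η.obj.app a ◁ G.map₂ α =
      eqToHom hf.symm ≫ F.map₂ α ▷ η.obj.app b ≫ eqToHom hg := by
    simp only [eqToIso.hom] at h
    rw [h]
    simp
  have h'' := congrArg (· ▷ x) h'
  simp only [comp_whiskerRight, eqToHom_whiskerRight, whisker_assoc_eq] at h''
  rw [whiskerRight_comp_eq]
  rw [← cancel_epi (eqToHom (Strict.assoc (η.obj.app a) (G.map f) x)),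
    ← cancel_mono (eqToHom (Strict.assoc (η.obj.app a) (G.map g) x).symm)]
  simp only [Category.assoc]
  rw [h'']
  simp

lemma isTwoNatural_id (F : StrictPseudofunctor B C) : IsTwoNatural F F (𝟙 F.toPseudofunctor) := by
  intro a b f
  refine ⟨by simp, ?_⟩
  ext
  simp [Strict.leftUnitor_eqToIso, Strict.rightUnitor_eqToIso]
  rfl

lemma IsTwoNatural.comp {F G H : StrictPseudofunctor B C} {η : Ps F G} {θ : Ps G H}
    (hη : IsTwoNatural F G η) (hθ : IsTwoNatural G H θ) : IsTwoNatural F H (η ≫ θ) := by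
  intro a b f
  obtain ⟨h, e⟩ := hη f
  obtain ⟨h', e'⟩ := hθ f
  have hc : F.map f ≫ (η ≫ θ).app b = (η ≫ θ).app a ≫ H.map f := by
    change F.map f ≫ η.app b ≫ θ.app b = (η.app a ≫ θ.app a) ≫ H.map f
    rw [← Category.assoc, h, Category.assoc, h', Category.assoc]
  refine ⟨hc, ?_⟩
  ext
  simp [e, e', Strict.associator_eqToIso]
  exact eqToHom_chain _ _ _ _ _ hc

/-- A 2-natural transformation, from its components and their (strict) naturality for 1-cells
and 2-cells. -/
def mkTwoNatural {F G : StrictPseudofunctor B C} (app : ∀ a, F.obj a ⟶ G.obj a)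
    (comm : ∀ {a b : B} (f : a ⟶ b), F.map f ≫ app b = app a ≫ G.map f)
    (comm₂ : ∀ {a b : B} {f g : a ⟶ b} (α : f ⟶ g),
      F.map₂ α ▷ app b = eqToHom (comm f) ≫ app a ◁ G.map₂ α ≫ eqToHom (comm g).symm) :
    Ps F G where
  app := app
  naturality f := eqToIso (comm f)
  naturality_naturality α := by
    rw [comm₂ α]
    simp
  naturality_id a := by
    rw [F.mapId_eq_eqToIso, G.mapId_eq_eqToIso]
    simp [Strict.leftUnitor_eqToIso, Strict.rightUnitor_eqToIso]
  naturality_comp f g := by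
    rw [F.mapComp_eq_eqToIso, G.mapComp_eq_eqToIso]
    simp [Strict.associator_eqToIso]

lemma modification_naturality {F G : StrictPseudofunctor B Cat.{v₂, u₂}} {η θ : Ps F G}
    (hη : IsTwoNatural F G η) (hθ : IsTwoNatural F G θ) {a b : B} (f : a ⟶ b)
    (m : η.app a ⟶ θ.app a) (m' : η.app b ⟶ θ.app b)
    (h : ∀ (x : F.obj a) e₁ e₂, m'.toNatTrans.app ((F.map f).toFunctor.obj x) ≫ eqToHom e₁ =
      eqToHom e₂ ≫ (G.map f).toFunctor.map (m.toNatTrans.app x)) :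
    F.map f ◁ m' ≫ (θ.naturality f).hom = (η.naturality f).hom ≫ m ▷ G.map f := by
  obtain ⟨h₁, e₁⟩ := hη f
  obtain ⟨h₂, e₂⟩ := hθ f
  rw [e₁, e₂]
  refine cat_hom₂_ext fun x => (comp_eqToHom_app _ h₂ x).trans (Eq.trans ?_
          (eqToHom_comp_app h₁ _ x).symm)
  exact h x _ _

/-- A functor is an isomorphism of categories: fully faithful and bijective on objects. -/
def IsIsoOfCategories {X : Type u₁} [Category.{v₁} X] {Y : Type u₂} [Category.{v₂} Y]
    (F : X ⥤ Y) : Prop := F.Full ∧ F.Faithful ∧ Function.Bijective F.obj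

/-- A 1-cell is an equivalence (it has an inverse up to invertible 2-cells). -/
def IsEquiv₁ {a b : C} (f : a ⟶ b) : Prop := ∃ e : Bicategory.Equivalence a b, e.hom = f

end Transformations

section Hom

variable {J : Type u₁} [Bicategory.{w₁, v₁} J] [Bicategory.Strict J]
  {C : Type u₂} [Bicategory.{w₂, v₂} C] [Bicategory.Strict C]

/-- For a diagram `D : Jᵒᵖ → C` and `A : C`, the 2-functor `C(D-, A) : J → Cat`. -/
def homInto (D : StrictPseudofunctor Jᵒᵖ C) (A : C) : StrictPseudofunctor J Cat.{w₂, v₂} :=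
  StrictPseudofunctor.mk''
    { obj j := Cat.of (D.obj (op j) ⟶ A)
      map f := (precomposingCat _ _ A).obj (D.map f.op)
      map₂ α := (precomposingCat _ _ A).map (D.map₂ (op2 α))
      map₂_id f := by
        rw [op2_id, D.map₂_id, CategoryTheory.Functor.map_id]
      map₂_comp η θ := by
        rw [op2_comp, D.map₂_comp, CategoryTheory.Functor.map_comp]
      map_id j := by
        rw [op_id, D.map_id, precomposingCat_id]
      map_comp f g := by
        rw [op_comp, D.map_comp, precomposingCat_comp]
      map₂_whisker_left f g g' η := by
        refine cat_hom₂_ext fun x => (?_ : _ = _).trans (conj_app _ _ _ x).symm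
        exact map₂_whiskerRight_whiskerRight D (op2 η) f.op x _ _
      map₂_whisker_right {a b c f f'} η g := by
        refine cat_hom₂_ext fun x => (?_ : _ = _).trans (conj_app _ _ _ x).symm
        exact map₂_whiskerLeft_whiskerRight D g.op (op2 η) x _ _ }

/-- For a diagram `D : J → C` and `A : C`, the 2-functor `C(A, D-) : J → Cat`. -/
def homFrom (A : C) (D : StrictPseudofunctor J C) : StrictPseudofunctor J Cat.{w₂, v₂} :=
  StrictPseudofunctor.mk''
    { obj j := Cat.of (A ⟶ D.obj j)
      map f := (postcomposingCat A _ _).obj (D.map f)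
      map₂ α := (postcomposingCat A _ _).map (D.map₂ α)
      map₂_id f := by
        rw [D.map₂_id, CategoryTheory.Functor.map_id]
      map₂_comp η θ := by
        rw [D.map₂_comp, CategoryTheory.Functor.map_comp]
      map_id j := by
        rw [D.map_id, postcomposingCat_id]
      map_comp f g := by
        rw [D.map_comp, postcomposingCat_comp]
      map₂_whisker_left f g g' η := by
        refine cat_hom₂_ext fun x => (?_ : _ = _).trans (conj_app _ _ _ x).symm
        exact whiskerLeft_map₂_whiskerLeft D f η x _ _
      map₂_whisker_right {a b c f f'} η g := by
        refine cat_hom₂_ext fun x => (?_ : _ = _).trans (conj_app _ _ _ x).symm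
        exact whiskerLeft_map₂_whiskerRight D η g x _ _ }

lemma postcomposingCat_precomposingCat {a b c d : C} (f : a ⟶ b) (g : c ⟶ d) :
    (precomposingCat a b c).obj f ≫ (postcomposingCat a c d).obj g =
      (postcomposingCat b c d).obj g ≫ (precomposingCat a b d).obj f :=
  Cat.ext (CategoryTheory.Functor.ext (fun x => Strict.assoc f x g)
    (fun _ _ m => whisker_assoc_eq f m g))

lemma precomposingCat_postcomposingCat {a b c d : C} (f : a ⟶ b) (g : c ⟶ d) :
    (postcomposingCat b c d).obj g ≫ (precomposingCat a b d).obj f =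
      (precomposingCat a b c).obj f ≫ (postcomposingCat a c d).obj g :=
  (postcomposingCat_precomposingCat f g).symm

lemma whisker_exchange_left {a b c d : C} {f g : a ⟶ b} (α : f ⟶ g) (x : b ⟶ c) (u : c ⟶ d) :
    (α ▷ x) ▷ u = eqToHom (Strict.assoc f x u) ≫ α ▷ (x ≫ u) ≫
      eqToHom (Strict.assoc g x u).symm := by
  simp [Strict.associator_eqToIso]

lemma whisker_exchange_right {a b c d : C} (u : a ⟶ b) (x : b ⟶ c) {f g : c ⟶ d} (α : f ⟶ g) :
    u ◁ x ◁ α = eqToHom (Strict.assoc u x f).symm ≫ (u ≫ x) ◁ α ≫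
      eqToHom (Strict.assoc u x g) := by
  simp [Strict.associator_eqToIso]

/-- The 2-natural transformation `C(D-, u) : C(D-, A) ⟶ C(D-, B)` for `u : A ⟶ B`. -/
def homIntoPost (D : StrictPseudofunctor Jᵒᵖ C) {A B : C} (u : A ⟶ B) :
    Ps (homInto D A) (homInto D B) :=
  mkTwoNatural (fun j => (postcomposingCat (D.obj (op j)) A B).obj u)
    (fun f => postcomposingCat_precomposingCat (D.map f.op) u)
    (fun α => by
      refine cat_hom₂_ext fun x => (?_ : _ = _).trans (conj_app _ _ _ x).symm
      exact whisker_exchange_left (D.map₂ (op2 α)) x u)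

lemma isTwoNatural_homIntoPost (D : StrictPseudofunctor Jᵒᵖ C) {A B : C} (u : A ⟶ B) :
    IsTwoNatural (homInto D A) (homInto D B) (homIntoPost D u) :=
  fun _ _ _ => ⟨_, rfl⟩

/-- The modification `C(D-, u) ⟶ C(D-, v)` for a 2-cell `u ⟶ v`. -/
def homIntoPostMap (D : StrictPseudofunctor Jᵒᵖ C) {A B : C} {u v : A ⟶ B} (β : u ⟶ v) :
    homIntoPost D u ⟶ homIntoPost D v where
  as :=
    { app j := Cat.Hom₂.ofNatTrans ((postcomposing (D.obj (op j)) A B).map β)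
      naturality f := by
        refine modification_naturality (isTwoNatural_homIntoPost D u) (isTwoNatural_homIntoPost D v) f _ _ fun x e₁ e₂ => ?_
        exact comp_whiskerLeft_eqToHom (D.map f.op) x β e₁ e₂ }

/-- The 2-natural transformation `C(u, D-) : C(B, D-) ⟶ C(A, D-)` for `u : A ⟶ B`. -/
def homFromPre {A B : C} (u : A ⟶ B) (D : StrictPseudofunctor J C) :
    Ps (homFrom B D) (homFrom A D) :=
  mkTwoNatural (fun j => (precomposingCat A B (D.obj j)).obj u)
    (fun f => precomposingCat_postcomposingCat u (D.map f))
    (fun α => by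
      refine cat_hom₂_ext fun x => (?_ : _ = _).trans (conj_app _ _ _ x).symm
      exact whisker_exchange_right u x (D.map₂ α))

lemma isTwoNatural_homFromPre {A B : C} (u : A ⟶ B) (D : StrictPseudofunctor J C) :
    IsTwoNatural (homFrom B D) (homFrom A D) (homFromPre u D) :=
  fun _ _ _ => ⟨_, rfl⟩

/-- The modification `C(u, D-) ⟶ C(v, D-)` for a 2-cell `u ⟶ v`. -/
def homFromPreMap {A B : C} {u v : A ⟶ B} (β : u ⟶ v) (D : StrictPseudofunctor J C) :
    homFromPre u D ⟶ homFromPre v D where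
  as :=
    { app j := Cat.Hom₂.ofNatTrans ((precomposing A B (D.obj j)).map β)
      naturality f := by
        refine modification_naturality (isTwoNatural_homFromPre u D) (isTwoNatural_homFromPre v D) f _ _ fun x e₁ e₂ => ?_
        exact whiskerRight_comp_eqToHom β x (D.map f) e₁ e₂ }

/-- The 2-natural transformation `C(f-, A) : C(E-, A) ⟶ C(D-, A)` for a 2-natural `f : D ⟶ E`. -/
def homIntoMap {D E : StrictPseudofunctor Jᵒᵖ C} (f : TwoNat D E) (A : C) :
    Ps (homInto E A) (homInto D A) :=
  mkTwoNatural (fun j => (precomposingCat _ _ A).obj (f.obj.app (op j)))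
    (fun {i j} g => ((precomposingCat_comp (f.obj.app (op j)) (E.map g.op) A).symm.trans
      (congrArg (precomposingCat _ _ A).obj (f.property g.op).choose.symm)).trans
        (precomposingCat_comp (D.map g.op) (f.obj.app (op i)) A))
    (fun α => by
      refine cat_hom₂_ext fun x => (?_ : _ = _).trans (conj_app _ _ _ x).symm
      exact twoNat_whisker f (op2 α) x _ _)

lemma isTwoNatural_homIntoMap {D E : StrictPseudofunctor Jᵒᵖ C} (f : TwoNat D E) (A : C) :
    IsTwoNatural (homInto E A) (homInto D A) (homIntoMap f A) :=
  fun _ _ _ => ⟨_, rfl⟩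

/-- For a pseudonatural `φ : W ⟶ C(D-, P)`, the functor `C(P, A) ⥤ Ps(J, Cat)(W, C(D-, A))`,
`u ↦ φ ≫ C(D-, u)`. -/
def inducedPs {W : StrictPseudofunctor J Cat.{w₂, v₂}} {D : StrictPseudofunctor Jᵒᵖ C} {P : C}
    (φ : Ps W (homInto D P)) (A : C) : (P ⟶ A) ⥤ Ps W (homInto D A) where
  obj u := φ ≫ homIntoPost D u
  map β := φ ◁ homIntoPostMap D β
  map_id u := by
    have : homIntoPostMap D (𝟙 u) = 𝟙 _ := by
      apply Pseudofunctor.StrongTrans.homCategory.ext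
      intro j
      exact cat_hom₂_ext fun x => whiskerLeft_id x u
    rw [this, Bicategory.whiskerLeft_id]
  map_comp {u v w} β γ := by
    have : homIntoPostMap D (β ≫ γ) = homIntoPostMap D β ≫ homIntoPostMap D γ := by
      apply Pseudofunctor.StrongTrans.homCategory.ext
      intro j
      exact cat_hom₂_ext fun x => whiskerLeft_comp x β γ
    rw [this, Bicategory.whiskerLeft_comp]

/-- For a 2-natural `φ : W ⟶ C(D-, P)`, the functor `C(P, A) ⥤ [J, Cat](W, C(D-, A))`,
`u ↦ φ ≫ C(D-, u)`. -/
def inducedTwoNat {W : StrictPseudofunctor J Cat.{w₂, v₂}} {D : StrictPseudofunctor Jᵒᵖ C} {P : C}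
    (φ : TwoNat W (homInto D P)) (A : C) : (P ⟶ A) ⥤ TwoNat W (homInto D A) :=
  ObjectProperty.lift _ (inducedPs φ.obj A)
    (fun u => φ.property.comp (isTwoNatural_homIntoPost D u))

/-- For a 2-natural `φ : W ⟶ C(P, D-)`, the functor `C(A, P) ⥤ [J, Cat](W, C(A, D-))`,
`u ↦ φ ≫ C(u, D-)`. -/
def inducedFrom {W : StrictPseudofunctor J Cat.{w₂, v₂}} {D : StrictPseudofunctor J C} {P : C}
    (φ : TwoNat W (homFrom P D)) (A : C) : (A ⟶ P) ⥤ TwoNat W (homFrom A D) :=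
  ObjectProperty.lift _
    { obj u := φ.obj ≫ homFromPre u D
      map β := φ.obj ◁ homFromPreMap β D
      map_id u := by
        have : homFromPreMap (𝟙 u) D = 𝟙 _ := by
          apply Pseudofunctor.StrongTrans.homCategory.ext
          intro j
          exact cat_hom₂_ext fun x => id_whiskerRight u x
        rw [this, Bicategory.whiskerLeft_id]
      map_comp {u v w} β γ := by
        have : homFromPreMap (β ≫ γ) D = homFromPreMap β D ≫ homFromPreMap γ D := by
          apply Pseudofunctor.StrongTrans.homCategory.ext
          intro j
          exact cat_hom₂_ext fun x => comp_whiskerRight β γ x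
        rw [this, Bicategory.whiskerLeft_comp] }
    (fun u => φ.property.comp (isTwoNatural_homFromPre u D))
end Hom

section Classifier

variable {B : Type u₁} [Bicategory.{w₁, v₁} B] {C : Type u₂} [Bicategory.{w₂, v₂} C]

/-- Restriction along `p : W ⟶ Q`, as a functor `[B, C](Q, X) ⥤ Ps(B, C)(W, X)`. -/
def precompUnit {W Q : StrictPseudofunctor B C} (p : Ps W Q) (X : StrictPseudofunctor B C) :
    TwoNat Q X ⥤ Ps W X :=
  (IsTwoNatural Q X).ι ⋙ Bicategory.precomp X.toPseudofunctor p

/-- A pseudomorphism classifier of `W`: the value `obj = QW` at `W` of the left 2-adjoint of the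
inclusion `[B, C] → Ps(B, C)`, with the unit `p_W : W ⟶ QW` (pseudonatural). Composition with
`p_W` is an isomorphism of categories `[B, C](QW, X) ≅ Ps(B, C)(W, X)` for every `X`. -/
structure PseudomorphismClassifier (W : StrictPseudofunctor B C) where
  obj : StrictPseudofunctor B C
  unit : Ps W obj
  universal (X : StrictPseudofunctor B C) : IsIsoOfCategories (precompUnit unit X)

/-- The counit `q_W : QW ⟶ W`: the unique 2-natural transformation with `p_W ≫ q_W = 1`. -/
noncomputable def PseudomorphismClassifier.counit {W : StrictPseudofunctor B C}
    (K : PseudomorphismClassifier W) :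
    TwoNat K.obj W :=
  ((K.universal W).2.2.2 (𝟙 W.toPseudofunctor)).choose

lemma PseudomorphismClassifier.unit_counit {W : StrictPseudofunctor B C}
    (K : PseudomorphismClassifier W) :
    K.unit ≫ K.counit.obj = 𝟙 W.toPseudofunctor :=
  ((K.universal W).2.2.2 (𝟙 W.toPseudofunctor)).choose_spec

end Classifier

section Weights

variable {J : Type u₁} [Bicategory.{w₁, v₁} J]

section Pointwise

lemma toFunctor_map_eq {X Y : Cat.{v₂, u₂}} {F G : X ⟶ Y} (h : F = G) {x y : X} (m : x ⟶ y) :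
    F.toFunctor.map m = eqToHom congr(($h).toFunctor.obj x) ≫ G.toFunctor.map m ≫
      eqToHom congr(($h).toFunctor.obj y).symm := by
  subst h; simp

variable (F : StrictPseudofunctor J Cat.{v₂, u₂})

lemma obj_id {j : J} (x : F.obj j) : (F.map (𝟙 j)).toFunctor.obj x = x :=
  congr(($(F.map_id j)).toFunctor.obj x)

lemma obj_comp {i j k : J} (f : i ⟶ j) (g : j ⟶ k) (x : F.obj i) :
    (F.map (f ≫ g)).toFunctor.obj x = (F.map g).toFunctor.obj ((F.map f).toFunctor.obj x) :=
  congr(($(F.map_comp f g)).toFunctor.obj x)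

lemma map_id_map {j : J} {x y : F.obj j} (m : x ⟶ y) : (F.map (𝟙 j)).toFunctor.map m =
    eqToHom (obj_id F x) ≫ m ≫ eqToHom (obj_id F y).symm :=
  toFunctor_map_eq (F.map_id j) m

lemma map_comp_map {i j k : J} (f : i ⟶ j) (g : j ⟶ k) {x y : F.obj i} (m : x ⟶ y) :
    (F.map (f ≫ g)).toFunctor.map m =
    eqToHom (obj_comp F f g x) ≫ (F.map g).toFunctor.map ((F.map f).toFunctor.map m) ≫
      eqToHom (obj_comp F f g y).symm :=
  toFunctor_map_eq (F.map_comp f g) m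

lemma map₂_whiskerLeft_app {i j k : J} (f : i ⟶ j) {g h : j ⟶ k} (η : g ⟶ h) (x : F.obj i) :
    (F.map₂ (f ◁ η)).toNatTrans.app x = eqToHom (obj_comp F f g x) ≫
      (F.map₂ η).toNatTrans.app ((F.map f).toFunctor.obj x) ≫
        eqToHom (obj_comp F f h x).symm := by
  rw [F.map₂_whisker_left, F.mapComp_eq_eqToIso, F.mapComp_eq_eqToIso]
  exact conj_app (F.map_comp f g) (F.map_comp f h).symm _ x

lemma map₂_whiskerRight_app {i j k : J} {f g : i ⟶ j} (η : f ⟶ g) (h : j ⟶ k) (x : F.obj i) :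
    (F.map₂ (η ▷ h)).toNatTrans.app x = eqToHom (obj_comp F f h x) ≫
      (F.map h).toFunctor.map ((F.map₂ η).toNatTrans.app x) ≫
        eqToHom (obj_comp F g h x).symm := by
  rw [F.map₂_whisker_right, F.mapComp_eq_eqToIso, F.mapComp_eq_eqToIso]
  exact conj_app (F.map_comp f h) (F.map_comp g h).symm _ x

variable {F} {G : StrictPseudofunctor J Cat.{v₂, u₂}} (σ : Ps F G)

/-- The component at `x` of the structure 2-cell of `σ` at `f`. -/
def nat {i j : J} (f : i ⟶ j) (x : F.obj i) :
    (σ.app j).toFunctor.obj ((F.map f).toFunctor.obj x) ≅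
      (G.map f).toFunctor.obj ((σ.app i).toFunctor.obj x) :=
  (Cat.Hom.toNatIso (σ.naturality f)).app x

lemma nat_naturality {i j : J} (f : i ⟶ j) {x y : F.obj i} (m : x ⟶ y) :
    (σ.app j).toFunctor.map ((F.map f).toFunctor.map m) ≫ (nat σ f y).hom =
      (nat σ f x).hom ≫ (G.map f).toFunctor.map ((σ.app i).toFunctor.map m) :=
  (σ.naturality f).hom.toNatTrans.naturality m

lemma nat_map₂ {i j : J} {f g : i ⟶ j} (α : f ⟶ g) (x : F.obj i) :
    (σ.app j).toFunctor.map ((F.map₂ α).toNatTrans.app x) ≫ (nat σ g x).hom =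
      (nat σ f x).hom ≫ (G.map₂ α).toNatTrans.app ((σ.app i).toFunctor.obj x) :=
  congr(($(σ.naturality_naturality α)).toNatTrans.app x)

lemma nat_id {j : J} (x : F.obj j) : (nat σ (𝟙 j) x).hom =
    eqToHom (by rw [obj_id, obj_id]) := by
  have h := congr(($(σ.naturality_id j)).toNatTrans.app x)
  rw [F.mapId_eq_eqToIso, G.mapId_eq_eqToIso] at h
  change (nat σ (𝟙 j) x).hom ≫ (eqToHom (G.map_id j)).toNatTrans.app _ =
    (σ.app j).toFunctor.map ((eqToHom (F.map_id j)).toNatTrans.app x) ≫ 𝟙 _ ≫ 𝟙 _ at h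
  rw [Cat.eqToHom_app, Cat.eqToHom_app, eqToHom_map, Category.comp_id, Category.comp_id] at h
  rw [comp_eqToHom_iff] at h
  rw [h, eqToHom_trans]

lemma nat_comp {i j k : J} (f : i ⟶ j) (g : j ⟶ k) (x : F.obj i) : (nat σ (f ≫ g) x).hom =
    eqToHom (by rw [obj_comp]) ≫ (nat σ g ((F.map f).toFunctor.obj x)).hom ≫
      (G.map g).toFunctor.map (nat σ f x).hom ≫ eqToHom (by rw [obj_comp]) := by
  have h := congr(($(σ.naturality_comp f g)).toNatTrans.app x)
  rw [F.mapComp_eq_eqToIso, G.mapComp_eq_eqToIso] at h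
  change (nat σ (f ≫ g) x).hom ≫ (eqToHom (G.map_comp f g)).toNatTrans.app _ =
    (σ.app k).toFunctor.map ((eqToHom (F.map_comp f g)).toNatTrans.app x) ≫ 𝟙 _ ≫
      (nat σ g ((F.map f).toFunctor.obj x)).hom ≫ 𝟙 _ ≫
        (G.map g).toFunctor.map (nat σ f x).hom ≫ 𝟙 _ at h
  rw [Cat.eqToHom_app, Cat.eqToHom_app, eqToHom_map, Category.comp_id, Category.id_comp,
    Category.id_comp, comp_eqToHom_iff] at h
  rw [h, Category.assoc, Category.assoc]

lemma nat_congr {i j : J} {f g : i ⟶ j} (h : f = g) (x : F.obj i) :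
    (nat σ f x).hom = eqToHom (by rw [h]) ≫ (nat σ g x).hom ≫ eqToHom (by rw [h]) := by
  subst h; simp

lemma nat_comp_trans {H : StrictPseudofunctor J Cat.{v₂, u₂}} (τ : Ps G H) {i j : J} (f : i ⟶ j)
    (x : F.obj i) : (nat (σ ≫ τ) f x).hom =
      (τ.app j).toFunctor.map (nat σ f x).hom ≫ (nat τ f ((σ.app i).toFunctor.obj x)).hom := by
  change 𝟙 _ ≫ (τ.app j).toFunctor.map (nat σ f x).hom ≫ 𝟙 _ ≫
    (nat τ f ((σ.app i).toFunctor.obj x)).hom ≫ 𝟙 _ = _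
  simp only [Category.id_comp, Category.comp_id]

lemma IsTwoNatural.obj_eq {σ : Ps F G} (hσ : IsTwoNatural F G σ) {i j : J} (f : i ⟶ j)
    (x : F.obj i) : (σ.app j).toFunctor.obj ((F.map f).toFunctor.obj x) =
      (G.map f).toFunctor.obj ((σ.app i).toFunctor.obj x) :=
  congr(($((hσ f).choose)).toFunctor.obj x)

lemma IsTwoNatural.nat_eq {σ : Ps F G} (hσ : IsTwoNatural F G σ) {i j : J} (f : i ⟶ j)
    (x : F.obj i) : (nat σ f x).hom = eqToHom (hσ.obj_eq f x) := by
  obtain ⟨h, e⟩ := hσ f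
  change (σ.naturality f).hom.toNatTrans.app x = _
  rw [e]
  exact Cat.eqToHom_app _ _ h x

lemma modification_app {σ τ : Ps F G} (Γ : σ ⟶ τ) {i j : J} (f : i ⟶ j) (x : F.obj i) :
    (Γ.as.app j).toNatTrans.app ((F.map f).toFunctor.obj x) ≫ (nat τ f x).hom =
      (nat σ f x).hom ≫ (G.map f).toFunctor.map ((Γ.as.app i).toNatTrans.app x) :=
  congr(($(Γ.as.naturality f)).toNatTrans.app x)

lemma ps_ext {σ τ : Ps F G}
    (hobj : ∀ (j : J) (x : F.obj j), (σ.app j).toFunctor.obj x = (τ.app j).toFunctor.obj x)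
    (hmap : ∀ {j : J} {x y : F.obj j} (m : x ⟶ y), (σ.app j).toFunctor.map m =
      eqToHom (hobj j x) ≫ (τ.app j).toFunctor.map m ≫ eqToHom (hobj j y).symm)
    (hnat : ∀ {i j : J} (f : i ⟶ j) (x : F.obj i), (nat σ f x).hom =
      eqToHom (hobj j _) ≫ (nat τ f x).hom ≫ eqToHom (by rw [hobj])) : σ = τ := by
  have happ : σ.app = τ.app := by
    funext j
    exact Cat.ext (CategoryTheory.Functor.ext (hobj j) (fun _ _ m => hmap m))
  obtain ⟨a, n, n₁, n₂, n₃⟩ := σ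
  obtain ⟨a', n', n₁', n₂', n₃'⟩ := τ
  obtain rfl : a = a' := happ
  obtain rfl : @n = @n' := by
    funext i j f
    apply Iso.ext
    refine cat_hom₂_ext fun x => ?_
    exact (hnat f x).trans (by simp; rfl)
  rfl

lemma ps_ext_of_modification {σ τ : Ps F G} (Γ : σ ⟶ τ)
    (h : ∀ (j : J) (x : F.obj j), ∃ e, (Γ.as.app j).toNatTrans.app x = eqToHom e) : σ = τ := by
  choose e he using h
  refine ps_ext e (fun {j x y} m => ?_) (fun {i j} f x => ?_)
  · have := (Γ.as.app j).toNatTrans.naturality m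
    rw [he, he, comp_eqToHom_iff] at this
    rw [this, Category.assoc]
  · have := modification_app Γ f x
    rw [he, he, eqToHom_map] at this
    rw [← Category.assoc, ← comp_eqToHom_iff]
    · exact this.symm
    

/-- A pseudonatural transformation between `Cat`-valued 2-functors, from pointwise data. -/
def psMk (app : ∀ j, F.obj j ⟶ G.obj j)
    (s : ∀ {i j : J} (f : i ⟶ j) (x : F.obj i),
      (app j).toFunctor.obj ((F.map f).toFunctor.obj x) ≅
        (G.map f).toFunctor.obj ((app i).toFunctor.obj x))
    (s_nat : ∀ {i j : J} (f : i ⟶ j) {x y : F.obj i} (m : x ⟶ y),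
      (app j).toFunctor.map ((F.map f).toFunctor.map m) ≫ (s f y).hom =
        (s f x).hom ≫ (G.map f).toFunctor.map ((app i).toFunctor.map m))
    (s_map₂ : ∀ {i j : J} {f g : i ⟶ j} (α : f ⟶ g) (x : F.obj i),
      (app j).toFunctor.map ((F.map₂ α).toNatTrans.app x) ≫ (s g x).hom =
        (s f x).hom ≫ (G.map₂ α).toNatTrans.app ((app i).toFunctor.obj x))
    (s_id : ∀ {j : J} (x : F.obj j), (s (𝟙 j) x).hom = eqToHom (by rw [obj_id, obj_id]))
    (s_comp : ∀ {i j k : J} (f : i ⟶ j) (g : j ⟶ k) (x : F.obj i), (s (f ≫ g) x).hom =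
      eqToHom (by rw [obj_comp]) ≫ (s g ((F.map f).toFunctor.obj x)).hom ≫
        (G.map g).toFunctor.map (s f x).hom ≫ eqToHom (by rw [obj_comp])) : Ps F G where
  app := app
  naturality {i j} f := Cat.Hom.isoMk (F := (F.map f).toFunctor ⋙ (app j).toFunctor)
    (G := (app i).toFunctor ⋙ (G.map f).toFunctor) (NatIso.ofComponents (s f) (s_nat f))
  naturality_naturality α := cat_hom₂_ext (s_map₂ α)
  naturality_id j := by
    refine cat_hom₂_ext fun x => ?_
    rw [F.mapId_eq_eqToIso, G.mapId_eq_eqToIso]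
    change (s (𝟙 j) x).hom ≫ (eqToHom (G.map_id j)).toNatTrans.app _ =
      (app j).toFunctor.map ((eqToHom (F.map_id j)).toNatTrans.app x) ≫ 𝟙 _ ≫ 𝟙 _
    rw [Cat.eqToHom_app, Cat.eqToHom_app, eqToHom_map, Category.comp_id, Category.comp_id, s_id,
      eqToHom_trans]
  naturality_comp {i j k} f g := by
    refine cat_hom₂_ext fun x => ?_
    rw [F.mapComp_eq_eqToIso, G.mapComp_eq_eqToIso]
    change (s (f ≫ g) x).hom ≫ (eqToHom (G.map_comp f g)).toNatTrans.app _ =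
      (app k).toFunctor.map ((eqToHom (F.map_comp f g)).toNatTrans.app x) ≫ 𝟙 _ ≫
        (s g ((F.map f).toFunctor.obj x)).hom ≫ 𝟙 _ ≫
          (G.map g).toFunctor.map (s f x).hom ≫ 𝟙 _
    rw [Cat.eqToHom_app, Cat.eqToHom_app, eqToHom_map, Category.comp_id, Category.id_comp,
      Category.id_comp, s_comp]
    simp only [Category.assoc, eqToHom_trans, eqToHom_refl, Category.comp_id]

end Pointwise

end Weights

section Existence
variable {J : Type u} [Bicategory.{w₁, u} J] [Bicategory.Strict J] (W : StrictPseudofunctor J Cat.{u, u})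

/-- The objects of the value at `j` of the classifier of `W`: an arrow `i ⟶ j` with an object of
`W i`; morphisms are those between the images in `W j`. -/
structure QObj (j : J) : Type u where
  src : J
  arr : src ⟶ j
  pt : W.obj src

namespace QObj
variable {W}

abbrev val {j : J} (x : QObj W j) : W.obj j := (W.map x.arr).toFunctor.obj x.pt

@[ext]
structure Hom {j : J} (x y : QObj W j) : Type u where
  hom : x.val ⟶ y.val

instance (j : J) : Category (QObj W j) where
  Hom x y := Hom x y
  id x := ⟨𝟙 x.val⟩
  comp f g := ⟨f.hom ≫ g.hom⟩

@[ext]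
lemma hom_ext {j : J} {x y : QObj W j} {f g : x ⟶ y} (h : f.hom = g.hom) : f = g := Hom.ext h

@[simp] lemma id_hom {j : J} (x : QObj W j) : Hom.hom (𝟙 x) = 𝟙 x.val := rfl

@[simp] lemma comp_hom {j : J} {x y z : QObj W j} (f : x ⟶ y) (g : y ⟶ z) :
    (f ≫ g).hom = f.hom ≫ g.hom := rfl

@[simp] lemma eqToHom_hom {j : J} {x y : QObj W j} (h : x = y) :
    (eqToHom h).hom = eqToHom congr(($h).val) := by
  subst h; rfl

@[simps]
def isoMk {j : J} {x y : QObj W j} (e : x.val ≅ y.val) : x ≅ y where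
  hom := ⟨e.hom⟩
  inv := ⟨e.inv⟩

abbrev push {j k : J} (g : j ⟶ k) (x : QObj W j) : QObj W k := ⟨x.src, x.arr ≫ g, x.pt⟩

lemma val_push {j k : J} (g : j ⟶ k) (x : QObj W j) :
    (x.push g).val = (W.map g).toFunctor.obj x.val := obj_comp W x.arr g x.pt

abbrev incl {j : J} (x : W.obj j) : QObj W j := ⟨j, 𝟙 j, x⟩

lemma val_incl {j : J} (x : W.obj j) : (incl x : QObj W j).val = x := obj_id W x

lemma push_id {j : J} (x : QObj W j) : x.push (𝟙 j) = x := by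
  cases x; simp [push]

lemma push_comp {i j k : J} (f : i ⟶ j) (g : j ⟶ k) (x : QObj W i) :
    x.push (f ≫ g) = (x.push f).push g := by
  cases x; simp [push]

lemma push_incl {i j : J} (f : i ⟶ j) (x : W.obj i) : (incl x).push f = ⟨i, f, x⟩ := by
  simp [push, incl]

abbrev pushFunctor {j k : J} (g : j ⟶ k) : QObj W j ⥤ QObj W k where
  obj := push g
  map {x y} m := ⟨eqToHom (val_push g x) ≫ (W.map g).toFunctor.map m.hom ≫
    eqToHom (val_push g y).symm⟩

abbrev inclFunctor (W : StrictPseudofunctor J Cat.{u, u}) (j : J) : W.obj j ⥤ QObj W j where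
  obj := incl
  map {x y} m := ⟨eqToHom (val_incl x) ≫ m ≫ eqToHom (val_incl y).symm⟩

abbrev push₂ {j k : J} {f g : j ⟶ k} (α : f ⟶ g) :
    (pushFunctor f : QObj W j ⥤ QObj W k) ⟶ pushFunctor g where
  app x := ⟨eqToHom (val_push f x) ≫ (W.map₂ α).toNatTrans.app x.val ≫
    eqToHom (val_push g x).symm⟩
  naturality x y m := by ext; simp

lemma pushFunctor_id (j : J) : (pushFunctor (𝟙 j) : QObj W j ⥤ QObj W j) = 𝟭 _ := by
  refine CategoryTheory.Functor.ext push_id fun x y m => ?_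
  ext
  simp [map_id_map]

lemma pushFunctor_comp {i j k : J} (f : i ⟶ j) (g : j ⟶ k) :
    (pushFunctor (f ≫ g) : QObj W i ⥤ QObj W k) = pushFunctor f ⋙ pushFunctor g := by
  refine CategoryTheory.Functor.ext (push_comp f g) fun x y m => ?_
  ext
  simp [map_comp_map, eqToHom_map]

lemma push₂_whiskerLeft {i j k : J} (f : i ⟶ j) {g h : j ⟶ k} (η : g ⟶ h) (x : QObj W i)
    (e₁ : x.push (f ≫ g) = (x.push f).push g) (e₂ : (x.push f).push h = x.push (f ≫ h)) :
    (push₂ (f ◁ η)).app x = eqToHom e₁ ≫ (push₂ η).app (x.push f) ≫ eqToHom e₂ := by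
  ext
  simp only [comp_hom, eqToHom_hom]
  rw [map₂_whiskerLeft_app]
  change _ = eqToHom _ ≫ (eqToHom _ ≫ (W.map₂ η).toNatTrans.app (push f x).val ≫ eqToHom _) ≫
    eqToHom _
  rw [(W.map₂ η).toNatTrans.congr (val_push f x)]
  simp only [Category.assoc, eqToHom_map, eqToHom_trans, eqToHom_trans_assoc]

lemma push₂_whiskerRight {i j k : J} {f g : i ⟶ j} (η : f ⟶ g) (h : j ⟶ k) (x : QObj W i)
    (e₁ : x.push (f ≫ h) = (x.push f).push h) (e₂ : (x.push g).push h = x.push (g ≫ h)) :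
    (push₂ (η ▷ h)).app x = eqToHom e₁ ≫ (pushFunctor h).map ((push₂ η).app x) ≫ eqToHom e₂ := by
  ext
  simp only [comp_hom, eqToHom_hom]
  rw [map₂_whiskerRight_app]
  simp [eqToHom_map]

lemma val_incl_map {i j : J} (f : i ⟶ j) (x : W.obj i) :
    (incl ((W.map f).toFunctor.obj x) : QObj W j).val = ((incl x : QObj W i).push f).val := by
  rw [val_incl, val_push, val_incl]

lemma inclFunctor_nat {i j : J} (f : i ⟶ j) {x y : W.obj i} (m : x ⟶ y) :
    (inclFunctor W j).map ((W.map f).toFunctor.map m) ≫ (isoMk (eqToIso (val_incl_map f y))).hom =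
      (isoMk (eqToIso (val_incl_map f x))).hom ≫
        (pushFunctor f).map ((inclFunctor W i).map m) := by
  ext
  simp [eqToHom_map]

lemma inclFunctor_map₂ {i j : J} {f g : i ⟶ j} (α : f ⟶ g) (x : W.obj i) :
    (inclFunctor W j).map ((W.map₂ α).toNatTrans.app x) ≫
        (isoMk (eqToIso (val_incl_map g x))).hom =
      (isoMk (eqToIso (val_incl_map f x))).hom ≫ (push₂ α).app (incl x) := by
  ext
  simp only [comp_hom, isoMk_hom_hom]
  rw [(W.map₂ α).toNatTrans.congr (val_incl x)]
  simp only [Category.assoc, eqToHom_map, eqToHom_trans, eqToHom_trans_assoc, eqToIso.hom]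

lemma isoMk_eqToIso {j : J} {x y : QObj W j} (h : x = y) (h' : x.val = y.val) :
    (isoMk (eqToIso h')).hom = eqToHom h := by
  ext
  simp

lemma inclFunctor_id {j : J} (x : W.obj j)
    (e : (incl ((W.map (𝟙 j)).toFunctor.obj x) : QObj W j) = (incl x).push (𝟙 j)) :
    (isoMk (eqToIso (val_incl_map (𝟙 j) x))).hom = eqToHom e := isoMk_eqToIso _ _

lemma inclFunctor_comp {i j k : J} (f : i ⟶ j) (g : j ⟶ k) (x : W.obj i)
    (e₁ : (incl ((W.map (f ≫ g)).toFunctor.obj x) : QObj W k) =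
      incl ((W.map g).toFunctor.obj ((W.map f).toFunctor.obj x)))
    (e₂ : ((incl x : QObj W i).push f).push g = (incl x).push (f ≫ g)) :
    (isoMk (eqToIso (val_incl_map (f ≫ g) x))).hom = eqToHom e₁ ≫
      (isoMk (eqToIso (val_incl_map g ((W.map f).toFunctor.obj x)))).hom ≫
        (pushFunctor g).map (isoMk (eqToIso (val_incl_map f x))).hom ≫ eqToHom e₂ := by
  ext
  simp [eqToHom_map]

end QObj

/-- The underlying 2-functor of the pseudomorphism classifier of `W`. -/
def classifierObj : StrictPseudofunctor J Cat.{u, u} :=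
  StrictPseudofunctor.mk''
    { obj j := Cat.of (QObj W j)
      map f := (QObj.pushFunctor f).toCatHom
      map₂ α := (QObj.push₂ α).toCatHom₂
      map₂_id f := by
        refine cat_hom₂_ext fun x => ?_
        apply QObj.hom_ext
        change eqToHom _ ≫ (W.map₂ (𝟙 f)).toNatTrans.app x.val ≫ eqToHom _ = 𝟙 _
        rw [W.map₂_id]
        simp
      map₂_comp η θ := by
        refine cat_hom₂_ext fun x => ?_
        apply QObj.hom_ext
        change eqToHom _ ≫ (W.map₂ (η ≫ θ)).toNatTrans.app x.val ≫ eqToHom _ =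
          (eqToHom _ ≫ (W.map₂ η).toNatTrans.app x.val ≫ eqToHom _) ≫
            (eqToHom _ ≫ (W.map₂ θ).toNatTrans.app x.val ≫ eqToHom _)
        rw [W.map₂_comp]
        simp
      map_id j := congrArg _ (QObj.pushFunctor_id j)
      map_comp f g := congrArg _ (QObj.pushFunctor_comp f g)
      map₂_whisker_left f g g' η := by
        refine cat_hom₂_ext fun x => (?_ : _ = _).trans (conj_app _ _ _ x).symm
        exact QObj.push₂_whiskerLeft f η x _ _
      map₂_whisker_right {a b c f f'} η g := by
        refine cat_hom₂_ext fun x => (?_ : _ = _).trans (conj_app _ _ _ x).symm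
        exact QObj.push₂_whiskerRight η g x _ _ }

/-- The pseudonatural unit of the pseudomorphism classifier of `W`. -/
def classifierUnit : Ps W (classifierObj W) :=
  psMk (fun j => (QObj.inclFunctor W j).toCatHom)
    (fun {_ _} f x => QObj.isoMk (eqToIso (QObj.val_incl_map f x)))
    (fun {_ _} f {_ _} m => QObj.inclFunctor_nat f m)
    (fun {_ _ _ _} α x => QObj.inclFunctor_map₂ α x)
    (fun {_} x => QObj.inclFunctor_id x _)
    (fun {_ _ _} f g x => QObj.inclFunctor_comp f g x _ _)


variable {W} {X : StrictPseudofunctor J Cat.{u, u}}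

lemma classifierUnit_obj {j : J} (x : W.obj j) : ((classifierUnit W).app j).toFunctor.obj x = QObj.incl x := rfl

lemma classifierObj_map_incl {i j : J} (f : i ⟶ j) (x : W.obj i) :
    ((classifierObj W).map f).toFunctor.obj (QObj.incl x : QObj W i) = (⟨i, f, x⟩ : QObj W j) :=
  QObj.push_incl f x

section Lift

variable (σ : Ps W X)

abbrev liftApp (j : J) : QObj W j ⥤ X.obj j where
  obj y := (X.map y.arr).toFunctor.obj ((σ.app y.src).toFunctor.obj y.pt)
  map {y z} m := (nat σ y.arr y.pt).inv ≫ (σ.app j).toFunctor.map m.hom ≫ (nat σ z.arr z.pt).hom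

lemma liftApp_push_obj {j k : J} (g : j ⟶ k) (y : QObj W j) :
    (liftApp σ k).obj (y.push g) = (X.map g).toFunctor.obj ((liftApp σ j).obj y) :=
  obj_comp X y.arr g _

lemma nat_push {j k : J} (g : j ⟶ k) (y : QObj W j) :
    (nat σ (y.push g).arr (y.push g).pt).hom =
      eqToHom (by rw [← QObj.val_push]) ≫ (nat σ g y.val).hom ≫
        (X.map g).toFunctor.map (nat σ y.arr y.pt).hom ≫
          eqToHom (liftApp_push_obj σ g y).symm :=
  nat_comp σ y.arr g y.pt

lemma nat_push_inv {j k : J} (g : j ⟶ k) (y : QObj W j) :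
    (nat σ (y.push g).arr (y.push g).pt).inv =
      eqToHom (liftApp_push_obj σ g y) ≫ (X.map g).toFunctor.map (nat σ y.arr y.pt).inv ≫
        (nat σ g y.val).inv ≫ eqToHom (by rw [← QObj.val_push]) := by
  rw [← cancel_mono (nat σ (y.push g).arr (y.push g).pt).hom, Iso.inv_hom_id, nat_push]
  simp [← Functor.map_comp_assoc]

lemma liftApp_push_map {j k : J} (g : j ⟶ k) {y z : QObj W j} (m : y ⟶ z) :
    (liftApp σ k).map ((QObj.pushFunctor g).map m) =
      eqToHom (liftApp_push_obj σ g y) ≫ (X.map g).toFunctor.map ((liftApp σ j).map m) ≫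
        eqToHom (liftApp_push_obj σ g z).symm := by
  change (nat σ (y.push g).arr (y.push g).pt).inv ≫ (σ.app k).toFunctor.map
    (eqToHom _ ≫ (W.map g).toFunctor.map m.hom ≫ eqToHom _) ≫
      (nat σ (z.push g).arr (z.push g).pt).hom =
    eqToHom _ ≫ (X.map g).toFunctor.map ((nat σ y.arr y.pt).inv ≫
      (σ.app j).toFunctor.map m.hom ≫ (nat σ z.arr z.pt).hom) ≫ eqToHom _
  rw [nat_push, nat_push_inv]
  have h := nat_naturality σ g m.hom
  have h' : (nat σ g y.val).inv ≫ (σ.app k).toFunctor.map ((W.map g).toFunctor.map m.hom) ≫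
      (nat σ g z.val).hom = (X.map g).toFunctor.map ((σ.app j).toFunctor.map m.hom) := by
    rw [h, Iso.inv_hom_id_assoc]
  simp only [Functor.map_comp, eqToHom_map, Category.assoc, eqToHom_trans_assoc, eqToHom_refl,
    Category.id_comp]
  rw [← h']
  simp only [Category.assoc]

lemma liftApp_push₂ {j k : J} {f g : j ⟶ k} (α : f ⟶ g) (y : QObj W j) :
    (liftApp σ k).map ((QObj.push₂ α).app y) =
      eqToHom (liftApp_push_obj σ f y) ≫ (X.map₂ α).toNatTrans.app ((liftApp σ j).obj y) ≫
        eqToHom (liftApp_push_obj σ g y).symm := by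
  change (nat σ (y.push f).arr (y.push f).pt).inv ≫ (σ.app k).toFunctor.map
    (eqToHom _ ≫ (W.map₂ α).toNatTrans.app y.val ≫ eqToHom _) ≫
      (nat σ (y.push g).arr (y.push g).pt).hom = _
  rw [nat_push, nat_push_inv]
  have h := nat_map₂ σ α y.val
  have h' : (nat σ f y.val).inv ≫ (σ.app k).toFunctor.map ((W.map₂ α).toNatTrans.app y.val) ≫
      (nat σ g y.val).hom = (X.map₂ α).toNatTrans.app _ := by
    rw [h, Iso.inv_hom_id_assoc]
  have h'' : (X.map₂ α).toNatTrans.app ((liftApp σ j).obj y) =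
     (X.map f).toFunctor.map (nat σ y.arr y.pt).inv ≫
      (X.map₂ α).toNatTrans.app ((σ.app j).toFunctor.obj y.val) ≫
        (X.map g).toFunctor.map (nat σ y.arr y.pt).hom := by
    rw [← (X.map₂ α).toNatTrans.naturality, ← Functor.map_comp_assoc, Iso.inv_hom_id]
    simp
  rw [h'', ← h']
  simp only [Functor.map_comp, eqToHom_map, Category.assoc, eqToHom_trans_assoc, eqToHom_refl,
    Category.id_comp]

/-- The 2-natural transformation classifying a pseudonatural transformation `σ`. -/
def lift : Ps (classifierObj W) X :=
  mkTwoNatural (fun j => (liftApp σ j).toCatHom)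
    (fun {_ _} g => Cat.ext (CategoryTheory.Functor.ext (liftApp_push_obj σ g)
      (fun _ _ m => liftApp_push_map σ g m)))
    (fun {_ _ _ _} α => by
      refine cat_hom₂_ext fun y => (?_ : _ = _).trans (conj_app _ _ _ y).symm
      exact liftApp_push₂ σ α y)

lemma isTwoNatural_lift : IsTwoNatural (classifierObj W) X (lift σ) := fun _ _ _ => ⟨_, rfl⟩

lemma nat_id_inv {j : J} (x : W.obj j) : (nat σ (𝟙 j) x).inv =
    eqToHom (by rw [obj_id, obj_id]) := by
  rw [← cancel_mono (nat σ (𝟙 j) x).hom, Iso.inv_hom_id, nat_id, eqToHom_trans, eqToHom_refl]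

lemma classifierUnit_lift : classifierUnit W ≫ lift σ = σ := by
  refine ps_ext (fun j x => obj_id X _) (fun {j x y} m => ?_) (fun {i j} f x => ?_)
  · change (nat σ (𝟙 j) x).inv ≫ (σ.app j).toFunctor.map (eqToHom _ ≫ m ≫ eqToHom _) ≫
      (nat σ (𝟙 j) y).hom = _
    rw [nat_id, nat_id_inv]
    simp only [Functor.map_comp, eqToHom_map, Category.assoc, eqToHom_trans_assoc, eqToHom_trans]
    rfl
  · rw [nat_comp_trans, (isTwoNatural_lift σ).nat_eq]
    change ((nat σ (𝟙 j) ((W.map f).toFunctor.obj x)).inv ≫ (σ.app j).toFunctor.map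
      (eqToHom (by rw [obj_id, Strict.id_comp])) ≫ (nat σ (𝟙 i ≫ f) x).hom) ≫ eqToHom _ = _
    rw [nat_id_inv, eqToHom_map, nat_congr σ (Strict.id_comp f)]
    simp only [Category.assoc, eqToHom_trans_assoc]
    exact eqToHom_conj_trans _ _ _ _ _ _

end Lift

section FullyFaithful

def QObj.d {j : J} (y : QObj W j) : y ≅ QObj.incl y.val :=
  QObj.isoMk (eqToIso (QObj.val_incl y.val).symm)

def fill {j : J} {A B : QObj W j ⥤ X.obj j}
    (γ : QObj.inclFunctor W j ⋙ A ⟶ QObj.inclFunctor W j ⋙ B) : A ⟶ B where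
  app y := A.map y.d.hom ≫ γ.app y.val ≫ B.map y.d.inv
  naturality y z m := by
    have h := γ.naturality m.hom
    have h₁ : m ≫ z.d.hom = y.d.hom ≫ (QObj.inclFunctor W j).map m.hom := by
      ext; simp [QObj.d]
    have h₂ : (QObj.inclFunctor W j).map m.hom ≫ z.d.inv = y.d.inv ≫ m := by
      ext; simp [QObj.d]
    rw [← Functor.map_comp_assoc, h₁, Functor.map_comp_assoc]
    simp only [Functor.comp_map] at h
    rw [reassoc_of% h, ← Functor.map_comp, h₂]
    simp only [Functor.map_comp, Category.assoc]

lemma fill_incl {j : J} {A B : QObj W j ⥤ X.obj j}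
    (γ : QObj.inclFunctor W j ⋙ A ⟶ QObj.inclFunctor W j ⋙ B) (x : W.obj j) :
    (fill γ).app (QObj.incl x) = γ.app x := by
  have h : A.map ((QObj.inclFunctor W j).map (eqToHom (QObj.val_incl x))) ≫ γ.app x =
      γ.app (QObj.incl x).val ≫ B.map ((QObj.inclFunctor W j).map (eqToHom (QObj.val_incl x))) :=
    γ.naturality _
  have h₁ : (QObj.inclFunctor W j).map (eqToHom (QObj.val_incl x)) = (QObj.incl x).d.inv := by
    ext; simp [QObj.d]
  rw [h₁] at h
  change A.map (QObj.incl x).d.hom ≫ γ.app (QObj.incl x).val ≫ B.map (QObj.incl x).d.inv = _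
  rw [← h, ← Functor.map_comp_assoc, Iso.hom_inv_id]
  simp

lemma fill_push {j k : J} (g : j ⟶ k) {A B : QObj W j ⥤ X.obj j} {A' B' : QObj W k ⥤ X.obj k}
    (γ : QObj.inclFunctor W j ⋙ A ⟶ QObj.inclFunctor W j ⋙ B)
    (γ' : QObj.inclFunctor W k ⋙ A' ⟶ QObj.inclFunctor W k ⋙ B')
    (hA : QObj.pushFunctor g ⋙ A' = A ⋙ (X.map g).toFunctor)
    (hB : QObj.pushFunctor g ⋙ B' = B ⋙ (X.map g).toFunctor)
    (h : ∀ v : W.obj j, γ'.app ((W.map g).toFunctor.obj v) ≫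
      B'.map (QObj.isoMk (eqToIso (QObj.val_incl_map g v))).hom ≫
        eqToHom (CategoryTheory.Functor.congr_obj hB (QObj.incl v)) =
      A'.map (QObj.isoMk (eqToIso (QObj.val_incl_map g v))).hom ≫
        eqToHom (CategoryTheory.Functor.congr_obj hA (QObj.incl v)) ≫
          (X.map g).toFunctor.map (γ.app v)) (y : QObj W j) :
    (fill γ').app (y.push g) ≫ eqToHom (CategoryTheory.Functor.congr_obj hB y) =
      eqToHom (CategoryTheory.Functor.congr_obj hA y) ≫ (X.map g).toFunctor.map ((fill γ).app y) := by
  have hg : (X.map g).toFunctor.map (γ.app y.val) =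
      eqToHom (CategoryTheory.Functor.congr_obj hA (QObj.incl y.val)).symm ≫
        A'.map (QObj.isoMk (eqToIso (QObj.val_incl_map g y.val))).inv ≫
          γ'.app ((W.map g).toFunctor.obj y.val) ≫
      B'.map (QObj.isoMk (eqToIso (QObj.val_incl_map g y.val))).hom ≫
        eqToHom (CategoryTheory.Functor.congr_obj hB (QObj.incl y.val)) := by
    rw [h, ← Functor.map_comp_assoc, Iso.inv_hom_id]
    simp
  have hAd : A'.map ((QObj.pushFunctor g).map y.d.hom) = eqToHom _ ≫
      (X.map g).toFunctor.map (A.map y.d.hom) ≫ eqToHom _ :=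
    CategoryTheory.Functor.congr_hom hA y.d.hom
  have hBd : B'.map ((QObj.pushFunctor g).map y.d.inv) = eqToHom _ ≫
      (X.map g).toFunctor.map (B.map y.d.inv) ≫ eqToHom _ :=
    CategoryTheory.Functor.congr_hom hB y.d.inv
  have hn : γ'.app (y.push g).val =
      A'.map ((QObj.inclFunctor W k).map (eqToHom (QObj.val_push g y))) ≫
        γ'.app ((W.map g).toFunctor.obj y.val) ≫
          B'.map ((QObj.inclFunctor W k).map (eqToHom (QObj.val_push g y).symm)) := by
    have this : A'.map ((QObj.inclFunctor W k).map (eqToHom (QObj.val_push g y).symm)) ≫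
        γ'.app (y.push g).val = γ'.app ((W.map g).toFunctor.obj y.val) ≫
          B'.map ((QObj.inclFunctor W k).map (eqToHom (QObj.val_push g y).symm)) :=
      γ'.naturality _
    have h₁ : (QObj.inclFunctor W k).map (eqToHom (QObj.val_push g y)) ≫
        (QObj.inclFunctor W k).map (eqToHom (QObj.val_push g y).symm) = 𝟙 _ := by
      ext; simp
    rw [← this, ← Functor.map_comp_assoc, h₁]
    simp
  have e₁ : (y.push g).d.hom ≫ (QObj.inclFunctor W k).map (eqToHom (QObj.val_push g y)) =
      (QObj.pushFunctor g).map y.d.hom ≫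
        (QObj.isoMk (eqToIso (QObj.val_incl_map g y.val))).inv := by
    ext; simp [QObj.d, eqToHom_map]
  have e₂ : (QObj.inclFunctor W k).map (eqToHom (QObj.val_push g y).symm) ≫ (y.push g).d.inv =
      (QObj.isoMk (eqToIso (QObj.val_incl_map g y.val))).hom ≫
        (QObj.pushFunctor g).map y.d.inv := by
    ext; simp [QObj.d, eqToHom_map]
  change (A'.map (y.push g).d.hom ≫ γ'.app (y.push g).val ≫ B'.map (y.push g).d.inv) ≫ _ =
    _ ≫ (X.map g).toFunctor.map (A.map y.d.hom ≫ γ.app y.val ≫ B.map y.d.inv)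
  have e₁' := congrArg A'.map e₁
  have e₂' := congrArg B'.map e₂
  rw [Functor.map_comp, Functor.map_comp] at e₁' e₂'
  rw [hn, Functor.map_comp, Functor.map_comp, hg]
  simp only [Category.assoc]
  rw [reassoc_of% e₁', reassoc_of% e₂', hAd, hBd]
  simp

def fillModification (θ θ' : TwoNat (classifierObj W) X) (Γ : classifierUnit W ≫ θ.obj ⟶ classifierUnit W ≫ θ'.obj) :
    θ.obj ⟶ θ'.obj where
  as :=
    { app j := Cat.Hom₂.ofNatTrans (fill (A := (θ.obj.app j).toFunctor)
        (B := (θ'.obj.app j).toFunctor) (Γ.as.app j).toNatTrans)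
      naturality {j k} g := by
        refine modification_naturality θ.property θ'.property g _ _ fun y e₁ e₂ => ?_
        refine fill_push g (Γ.as.app j).toNatTrans (Γ.as.app k).toNatTrans
          congr(($((θ.property g).choose)).toFunctor)
          congr(($((θ'.property g).choose)).toFunctor) (fun v => ?_) y
        have h := modification_app Γ g v
        rw [nat_comp_trans, nat_comp_trans, θ.property.nat_eq, θ'.property.nat_eq] at h
        exact h.trans (Category.assoc _ _ _) }

lemma fillModification_incl (θ θ' : TwoNat (classifierObj W) X) (Γ : classifierUnit W ≫ θ.obj ⟶ classifierUnit W ≫ θ'.obj) :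
    classifierUnit W ◁ fillModification θ θ' Γ = Γ := by
  apply Pseudofunctor.StrongTrans.homCategory.ext
  intro j
  exact cat_hom₂_ext fun x => fill_incl (Γ.as.app j).toNatTrans x

lemma exists_rep {j : J} (y : (classifierObj W).obj j) : ∃ (i : J) (f : i ⟶ j) (x : W.obj i),
    y = ((classifierObj W).map f).toFunctor.obj (((classifierUnit W).app i).toFunctor.obj x) :=
  ⟨QObj.src y, QObj.arr y, QObj.pt y, (QObj.push_incl (QObj.arr y) (QObj.pt y)).symm⟩

lemma twoNat_modification_app {θ θ' : TwoNat (classifierObj W) X} (δ : θ.obj ⟶ θ'.obj) {i j : J}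
    (f : i ⟶ j) (x : (classifierObj W).obj i) :
    (δ.as.app j).toNatTrans.app (((classifierObj W).map f).toFunctor.obj x) =
      eqToHom (θ.property.obj_eq f x) ≫
        (X.map f).toFunctor.map ((δ.as.app i).toNatTrans.app x) ≫
          eqToHom (θ'.property.obj_eq f x).symm := by
  have h := modification_app δ f x
  rw [θ.property.nat_eq, θ'.property.nat_eq, comp_eqToHom_iff] at h
  rw [h, Category.assoc]

lemma classifierUnit_faithful {θ θ' : TwoNat (classifierObj W) X} {δ δ' : θ.obj ⟶ θ'.obj}
    (h : classifierUnit W ◁ δ = classifierUnit W ◁ δ') : δ = δ' := by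
  apply Pseudofunctor.StrongTrans.homCategory.ext
  intro j
  refine cat_hom₂_ext fun y => ?_
  obtain ⟨i, f, x, rfl⟩ := exists_rep y
  have h' : (δ.as.app i).toNatTrans.app (((classifierUnit W).app i).toFunctor.obj x) =
    (δ'.as.app i).toNatTrans.app (((classifierUnit W).app i).toFunctor.obj x) :=
    congr((($h).as.app i).toNatTrans.app x)
  rw [twoNat_modification_app, twoNat_modification_app, h']

lemma modification_eqToHom_app {σ τ : Ps W X} (h : σ = τ) (j : J) (x : W.obj j) :
    ∃ e, ((eqToHom h).as.app j).toNatTrans.app x = eqToHom e := by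
  subst h
  exact ⟨rfl, rfl⟩

lemma classifierUnit_injective {θ θ' : TwoNat (classifierObj W) X} (h : classifierUnit W ≫ θ.obj = classifierUnit W ≫ θ'.obj) :
    θ.obj = θ'.obj := by
  refine ps_ext_of_modification (fillModification θ θ' (eqToHom h)) fun j y => ?_
  obtain ⟨i, f, x, rfl⟩ := exists_rep y
  obtain ⟨e, he⟩ := modification_eqToHom_app h i x
  have h' : ((fillModification θ θ' (eqToHom h)).as.app i).toNatTrans.app
      (((classifierUnit W).app i).toFunctor.obj x) = ((eqToHom h).as.app i).toNatTrans.app x :=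
    fill_incl _ x
  have e' : (θ.obj.app i).toFunctor.obj (((classifierUnit W).app i).toFunctor.obj x) =
    (θ'.obj.app i).toFunctor.obj (((classifierUnit W).app i).toFunctor.obj x) := e
  have h'' : ((fillModification θ θ' (eqToHom h)).as.app i).toNatTrans.app
      (((classifierUnit W).app i).toFunctor.obj x) = eqToHom e' := h'.trans he
  rw [twoNat_modification_app, h'', eqToHom_map, eqToHom_trans, eqToHom_trans]
  exact ⟨_, rfl⟩

end FullyFaithful

theorem isIsoOfCategories_precompUnit_classifierUnit (W X : StrictPseudofunctor J Cat.{u, u}) :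
    IsIsoOfCategories (precompUnit (classifierUnit W) X) := by
  refine ⟨⟨fun {θ θ'} Γ => ?_⟩, ⟨fun {θ θ'} δ δ' h => ?_⟩, fun θ θ' h => ?_, fun σ => ?_⟩
  · exact ⟨ObjectProperty.homMk (fillModification θ θ' Γ), fillModification_incl θ θ' Γ⟩
  · exact ObjectProperty.hom_ext _ (classifierUnit_faithful (congrArg (fun t => t) h))
  · exact ObjectProperty.FullSubcategory.ext (classifierUnit_injective h)
  · exact ⟨⟨lift σ, isTwoNatural_lift σ⟩, classifierUnit_lift σ⟩

/-- Every weight on a small 2-category has a pseudomorphism classifier. -/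
def classifier (W : StrictPseudofunctor J Cat.{u, u}) : PseudomorphismClassifier W where
  obj := classifierObj W
  unit := classifierUnit W
  universal := isIsoOfCategories_precompUnit_classifierUnit W

end Existence

section Colimits

variable {J : Type u₁} [Bicategory.{w₁, v₁} J] [Bicategory.Strict J]
  {C : Type u₂} [Bicategory.{w₂, v₂} C] [Bicategory.Strict C]

/-- A `W`-weighted colimit `W⋆D` of the diagram `D : Jᵒᵖ → C`: an object with a 2-natural cocone
`W ⟶ C(D-, W⋆D)` inducing isomorphisms of categories `C(W⋆D, A) ≅ [J, Cat](W, C(D-, A))`. -/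
structure WeightedColimit (W : StrictPseudofunctor J Cat.{w₂, v₂})
    (D : StrictPseudofunctor Jᵒᵖ C) where
  pt : C
  cocone : TwoNat W (homInto D pt)
  isColimit (A : C) : IsIsoOfCategories (inducedTwoNat cocone A)

/-- A `W`-weighted limit of the diagram `D : J → C`: an object with a 2-natural cone
`W ⟶ C(pt, D-)` inducing isomorphisms of categories `C(A, pt) ≅ [J, Cat](W, C(A, D-))`. -/
structure WeightedLimit (W : StrictPseudofunctor J Cat.{w₂, v₂})
    (D : StrictPseudofunctor J C) where
  pt : C
  cone : TwoNat W (homFrom pt D)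
  isLimit (A : C) : IsIsoOfCategories (inducedFrom cone A)

/-- A pseudonatural `φ : W ⟶ C(D-, P)` exhibits `P` as a `W`-weighted bicolimit of `D`: the
functors `C(P, A) ⥤ Ps(J, Cat)(W, C(D-, A))` it induces are equivalences of categories. -/
def IsBicolimit {W : StrictPseudofunctor J Cat.{w₂, v₂}} {D : StrictPseudofunctor Jᵒᵖ C} {P : C}
    (φ : Ps W (homInto D P)) : Prop :=
  ∀ A : C, (inducedPs φ A).IsEquivalence

namespace WeightedColimit

variable {V W : StrictPseudofunctor J Cat.{w₂, v₂}} {D E : StrictPseudofunctor Jᵒᵖ C}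

/-- The unique 1-cell out of a weighted colimit corresponding to a 2-natural cocone. -/
noncomputable def desc (c : WeightedColimit W D) {A : C} (t : TwoNat W (homInto D A)) :
    c.pt ⟶ A :=
  ((c.isColimit A).2.2.2 t).choose

lemma fac (c : WeightedColimit W D) {A : C} (t : TwoNat W (homInto D A)) :
    c.cocone.obj ≫ homIntoPost D (c.desc t) = t.obj :=
  congrArg ObjectProperty.FullSubcategory.obj ((c.isColimit A).2.2.2 t).choose_spec

lemma desc_eq (c : WeightedColimit W D) {A : C} (t : TwoNat W (homInto D A)) (u : c.pt ⟶ A)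
    (h : c.cocone.obj ≫ homIntoPost D u = t.obj) : u = c.desc t :=
  (c.isColimit A).2.2.1
    (ObjectProperty.FullSubcategory.ext (h.trans (c.fac t).symm))

/-- The comparison `q⋆D : V⋆D ⟶ W⋆D` induced by a 2-natural `q : V ⟶ W`. -/
noncomputable def mapWeight (q : TwoNat V W) (c : WeightedColimit V D)
    (c' : WeightedColimit W D) : c.pt ⟶ c'.pt :=
  c.desc ⟨q.obj ≫ c'.cocone.obj, q.property.comp c'.cocone.property⟩

/-- The comparison `W⋆f : W⋆D ⟶ W⋆E` induced by a 2-natural `f : D ⟶ E`. -/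
noncomputable def mapDiagram (f : TwoNat D E) (c : WeightedColimit W D)
    (c' : WeightedColimit W E) : c.pt ⟶ c'.pt :=
  c.desc ⟨c'.cocone.obj ≫ homIntoMap f c'.pt,
    c'.cocone.property.comp (isTwoNatural_homIntoMap f c'.pt)⟩

end WeightedColimit

end Colimits

section Completeness

variable (C : Type v) [Bicategory.{u, u} C] [Bicategory.Strict C]

/-- A 2-category is cocomplete if it has all colimits weighted by small weights. -/
def IsCocomplete : Prop :=
  ∀ (J : Type u) [Bicategory.{u, u} J] [Bicategory.Strict J]
    (W : StrictPseudofunctor J Cat.{u, u}) (D : StrictPseudofunctor Jᵒᵖ C),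
    Nonempty (WeightedColimit W D)

/-- A 2-category is complete if it has all limits weighted by small weights. -/
def IsComplete : Prop :=
  ∀ (J : Type u) [Bicategory.{u, u} J] [Bicategory.Strict J]
    (W : StrictPseudofunctor J Cat.{u, u}) (D : StrictPseudofunctor J C),
    Nonempty (WeightedLimit W D)

end Completeness

end TwoCat

/-!
A 1-cell of `C` is an equivalence if and only if precomposition with it is an equivalence of
hom-categories for every codomain (`isEquiv₁_of_isEquivalence_precomp`), so each condition is a
statement about functors between categories of cocones.

*Comparison with the classifier.* A cocone under `D` weighted by `QW` is the same as a
pseudonatural cocone weighted by `W`. Under this isomorphism, precomposition with `q_W⋆D` becomes the comparison functor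
`C(W⋆D, A) ⥤ Ps(W, C(D-, A))`, because `p_W ≫ q_W = 1`; hence one is an equivalence exactly when the
other is (`isBicolimit_iff_isEquiv₁_mapWeight_counit`).

*Invariance of bicolimits.* For a 2-natural `f : D ⟶ E`, precomposition with `W⋆f` and
postcomposition with `C(f-, A)` form a square with the comparison functors of `W⋆D` and `W⋆E`
(`WeightedColimit.mapDiagramIso`). If `f` is a pointwise equivalence, then postcomposition with
`C(f-, A)` is an equivalence on categories of pseudonatural transformations
(`isEquivalence_postcomp`), and two-out-of-three shows that `W⋆f` is an equivalence when both
colimits are bicolimits.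

*Bicolimits from invariance.* The diagram `D` has a classifier of its own, `q : QD ⟶ D`, in
which `QD j` represents the pseudonatural cocones `Ps(J(j, -), C(D-, A))`; it exists in a cocomplete `C` as the
colimit of `D` weighted by the pseudomorphism classifier of `J(j, -)`. By the bicategorical Yoneda
lemma each `q_j` is an equivalence (`DiagramClassifier.isEquiv₁_counitApp`). A pseudonatural
`σ : W ⟶ C(D-, A)` gives a 2-natural `W ⟶ C(QD-, A)`, whose value at `x` represents the composite of
`σ` with the transformation `J(j, -) ⟶ W` named by `x`, and which is isomorphic to
`σ ≫ C(q-, A)` (`DiagramClassifier.strictificationIso`). Hence every pseudonatural cocone under `QD`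
is isomorphic to a 2-natural one, and `W⋆QD` is always a bicolimit
(`DiagramClassifier.isBicolimit_diagram`). If `W⋆q` is an equivalence, the square above shows that
`W⋆D` is one as well.

Parallel composites of 1-cells in a strict 2-category are equal, but not definitionally so. Equations
between 2-cells are therefore stated as heterogeneous equalities where the boundaries agree only
propositionally, and are converted to conjugation by `eqToHom` at the end.
-/

namespace TwoCat

/-! ### Equivalences in a 2-category are detected by precomposition -/

section Representable

variable {C : Type u₂} [Bicategory.{w₂, v₂} C] [Bicategory.Strict C]

lemma IsEquiv₁.isEquivalence_precomp {a b : C} {f : a ⟶ b} (hf : IsEquiv₁ f) (A : C) :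
    (Bicategory.precomp A f).IsEquivalence := by
  obtain ⟨e, rfl⟩ := hf
  exact (CategoryTheory.Equivalence.mk (Bicategory.precomp A e.hom) (Bicategory.precomp A e.inv)
    ((leftUnitorNatIso b A).symm ≪≫ (precomposing b b A).mapIso e.counit.symm ≪≫
      associatorNatIsoRight e.inv e.hom A)
    ((associatorNatIsoRight e.hom e.inv A).symm ≪≫ (precomposing a a A).mapIso e.unit.symm ≪≫
      leftUnitorNatIso a A)).isEquivalence_functor

/-- A 1-cell is an equivalence once precomposition with it is an equivalence of categories for
every codomain: the inverse is a preimage of the identity. -/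
lemma isEquiv₁_of_isEquivalence_precomp {a b : C} {f : a ⟶ b}
    (hf : ∀ A : C, (Bicategory.precomp A f).IsEquivalence) : IsEquiv₁ f := by
  have := hf a
  have := hf b
  let g : b ⟶ a := (Bicategory.precomp a f).objPreimage (𝟙 a)
  let i : f ≫ g ≅ 𝟙 a := (Bicategory.precomp a f).objObjPreimageIso (𝟙 a)
  let k : g ≫ f ≅ 𝟙 b := (Bicategory.precomp b f).preimageIso
    ((α_ f g f).symm ≪≫ whiskerRightIso i f ≪≫ λ_ f ≪≫ (ρ_ f).symm)
  exact ⟨Bicategory.Equivalence.mkOfAdjointifyCounit i.symm k, rfl⟩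

end Representable

/-! ### Comparing 2-cells up to transport -/

section TransportCat

variable {X : Type u₁} [Category.{v₁} X]

lemma heq_conj {a b c d : X} (h₁ : a = b) (m : b ⟶ c) (h₂ : c = d) :
    eqToHom h₁ ≫ m ≫ eqToHom h₂ ≍ m := by
  subst h₁ h₂; simp

lemma heq_conj_comp {a b c d e : X} (h₁ : a = b) (m : b ⟶ c) (n : c ⟶ d) (h₂ : d = e) :
    eqToHom h₁ ≫ m ≫ n ≫ eqToHom h₂ ≍ m ≫ n := by
  subst h₁ h₂; simp

lemma heq_comp_comp_eqToHom {a b c d : X} (m : a ⟶ b) (n : b ⟶ c) (h : c = d) :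
    m ≫ n ≫ eqToHom h ≍ m ≫ n := by
  subst h; simp

lemma heq_functor_map {Y : Type u₂} [Category.{v₂} Y] (F : X ⥤ Y) {a b a' b' : X}
    {m : a ⟶ b} {m' : a' ⟶ b'} (ha : a = a') (hb : b = b') (hm : m ≍ m') :
    F.map m ≍ F.map m' := by
  subst ha hb; rw [eq_of_heq hm]

end TransportCat

section Transport

variable {C : Type u₂} [Bicategory.{w₂, v₂} C]

lemma heq_whiskerLeft {a b c : C} {f f' : a ⟶ b} {g g' h h' : b ⟶ c} {m : g ⟶ h} {m' : g' ⟶ h'}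
    (hf : f = f') (hg : g = g') (hh : h = h') (hm : m ≍ m') : f ◁ m ≍ f' ◁ m' := by
  subst hf hg hh; rw [eq_of_heq hm]

lemma heq_whiskerRight {a b c : C} {f f' g g' : a ⟶ b} {h h' : b ⟶ c} {m : f ⟶ g} {m' : f' ⟶ g'}
    (hf : f = f') (hg : g = g') (hh : h = h') (hm : m ≍ m') : m ▷ h ≍ m' ▷ h' := by
  subst hf hg hh; rw [eq_of_heq hm]

lemma heq_map₂_whiskerLeft {B : Type u₁} [Bicategory.{w₁, v₁} B] (D : StrictPseudofunctor B C)
    {x y z : B} (h : x ⟶ y) {f g : y ⟶ z} (α : f ⟶ g) :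
    D.map₂ (h ◁ α) ≍ D.map h ◁ D.map₂ α := by
  rw [D.map₂_whisker_left, D.mapComp_eq_eqToIso, D.mapComp_eq_eqToIso]
  exact heq_conj (D.map_comp h f) _ (D.map_comp h g).symm

variable [Bicategory.Strict C]

lemma heq_comp_whiskerLeft {a b c d : C} (f : a ⟶ b) (g : b ⟶ c) {x y : c ⟶ d} (m : x ⟶ y) :
    (f ≫ g) ◁ m ≍ f ◁ g ◁ m := by
  rw [comp_whiskerLeft_eq]; exact heq_conj _ _ _

lemma heq_whiskerRight_comp {a b c d : C} {x y : a ⟶ b} (m : x ⟶ y) (f : b ⟶ c) (g : c ⟶ d) :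
    m ▷ (f ≫ g) ≍ m ▷ f ▷ g := by
  rw [whiskerRight_comp_eq]; exact heq_conj _ _ _

lemma heq_whisker_assoc {a b c d : C} (f : a ⟶ b) {x y : b ⟶ c} (m : x ⟶ y) (g : c ⟶ d) :
    (f ◁ m) ▷ g ≍ f ◁ m ▷ g := by
  rw [whisker_assoc_eq]; exact heq_conj _ _ _

lemma heq_id_whiskerLeft {a b : C} {f g : a ⟶ b} (m : f ⟶ g) : 𝟙 a ◁ m ≍ m := by
  rw [id_whiskerLeft_eq]; exact heq_conj _ _ _

lemma heq_whiskerRight_id {a b : C} {f g : a ⟶ b} (m : f ⟶ g) : m ▷ 𝟙 b ≍ m := by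
  rw [whiskerRight_id_eq]; exact heq_conj _ _ _

end Transport

/-! ### Pseudonatural transformations into the 2-category of categories -/

section PsCat

variable {J : Type u₁} [Bicategory.{w₁, v₁} J]
  {F G H K : StrictPseudofunctor J Cat.{v₂, u₂}}

/-- Extensionality for pseudonatural transformations, without transports. -/
lemma ps_hext {σ τ : Ps F G}
    (hobj : ∀ (j : J) (x : F.obj j), (σ.app j).toFunctor.obj x = (τ.app j).toFunctor.obj x)
    (hmap : ∀ {j : J} {x y : F.obj j} (m : x ⟶ y),
      (σ.app j).toFunctor.map m ≍ (τ.app j).toFunctor.map m)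
    (hnat : ∀ {i j : J} (f : i ⟶ j) (x : F.obj i), (nat σ f x).hom ≍ (nat τ f x).hom) :
    σ = τ :=
  ps_ext hobj (fun m => (conj_eqToHom_iff_heq' _ _ _ _).2 (hmap m))
    (fun f x => (conj_eqToHom_iff_heq' _ _ _ _).2 (hnat f x))

lemma heq_nat_of_isTwoNatural {σ τ : Ps F G} (hσ : IsTwoNatural F G σ) (hτ : IsTwoNatural F G τ)
    (hobj : ∀ (j : J) (x : F.obj j), (σ.app j).toFunctor.obj x = (τ.app j).toFunctor.obj x)
    {i j : J} (f : i ⟶ j) (x : F.obj i) : (nat σ f x).hom ≍ (nat τ f x).hom := by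
  rw [hσ.nat_eq, hτ.nat_eq]
  exact ((eqToHom_heq_id_dom _ _ _).trans (by rw [hobj])).trans (eqToHom_heq_id_dom _ _ _).symm

/-- Composition of pseudonatural transformations between `Cat`-valued 2-functors is strictly
associative, because that of functors is. -/
lemma ps_assoc (σ : Ps F G) (τ : Ps G H) (ρ : Ps H K) : (σ ≫ τ) ≫ ρ = σ ≫ τ ≫ ρ := by
  refine ps_hext (fun _ _ => rfl) (fun _ => HEq.rfl) (fun {i j} f x => heq_of_eq ?_)
  simp only [nat_comp_trans]
  erw [Functor.map_comp, Category.assoc]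
  rfl

lemma nat_id_trans {i j : J} (f : i ⟶ j) (x : F.obj i) :
    (nat (𝟙 F.toPseudofunctor) f x).hom = 𝟙 _ := by
  exact Category.comp_id (𝟙 ((F.map f).toFunctor.obj x))

lemma ps_id_comp (σ : Ps F G) : 𝟙 F.toPseudofunctor ≫ σ = σ := by
  refine ps_hext (fun _ _ => rfl) (fun _ => HEq.rfl) (fun {i j} f x => heq_of_eq ?_)
  rw [nat_comp_trans, nat_id_trans]
  exact (congrArg (· ≫ (nat σ f x).hom) ((σ.app j).toFunctor.map_id _)).trans
    (Category.id_comp _)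

lemma ps_comp_id (σ : Ps F G) : σ ≫ 𝟙 G.toPseudofunctor = σ := by
  refine ps_hext (fun _ _ => rfl) (fun _ => HEq.rfl) (fun {i j} f x => heq_of_eq ?_)
  rw [nat_comp_trans, nat_id_trans]
  exact Category.comp_id (nat σ f x).hom

/-- An isomorphism of pseudonatural transformations, from pointwise isomorphisms. -/
def psIsoMk {σ τ : Ps F G}
    (e : ∀ (j : J) (x : F.obj j), (σ.app j).toFunctor.obj x ≅ (τ.app j).toFunctor.obj x)
    (e_nat : ∀ {j : J} {x y : F.obj j} (m : x ⟶ y),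
      (σ.app j).toFunctor.map m ≫ (e j y).hom = (e j x).hom ≫ (τ.app j).toFunctor.map m)
    (e_mod : ∀ {i j : J} (f : i ⟶ j) (x : F.obj i),
      (e j ((F.map f).toFunctor.obj x)).hom ≫ (nat τ f x).hom =
        (nat σ f x).hom ≫ (G.map f).toFunctor.map (e i x).hom) : σ ≅ τ :=
  Pseudofunctor.StrongTrans.isoMk
    (fun j => Cat.Hom.isoMk (F := (σ.app j).toFunctor) (G := (τ.app j).toFunctor)
      (NatIso.ofComponents (e j) e_nat))
    (fun {_ _} f => cat_hom₂_ext fun x => e_mod f x)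

/-- A modification between pseudonatural transformations, from pointwise data. -/
def modMk {σ τ : Ps F G}
    (e : ∀ (j : J) (x : F.obj j), (σ.app j).toFunctor.obj x ⟶ (τ.app j).toFunctor.obj x)
    (e_nat : ∀ {j : J} {x y : F.obj j} (m : x ⟶ y),
      (σ.app j).toFunctor.map m ≫ e j y = e j x ≫ (τ.app j).toFunctor.map m)
    (e_mod : ∀ {i j : J} (f : i ⟶ j) (x : F.obj i),
      e j ((F.map f).toFunctor.obj x) ≫ (nat τ f x).hom =
        (nat σ f x).hom ≫ (G.map f).toFunctor.map (e i x)) : σ ⟶ τ where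
  as :=
    { app j := Cat.Hom₂.ofNatTrans { app := e j, naturality _ _ m := e_nat m }
      naturality {_ _} f := cat_hom₂_ext fun x => e_mod f x }

/-- Two 2-natural transformations that agree pointwise are isomorphic, by identities. -/
def psIsoOfEq {σ τ : Ps F G} (hσ : IsTwoNatural F G σ) (hτ : IsTwoNatural F G τ)
    (hobj : ∀ (j : J) (x : F.obj j), (σ.app j).toFunctor.obj x = (τ.app j).toFunctor.obj x)
    (hmap : ∀ {j : J} {x y : F.obj j} (m : x ⟶ y),
      (σ.app j).toFunctor.map m ≍ (τ.app j).toFunctor.map m) : σ ≅ τ :=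
  psIsoMk (fun j x => eqToIso (hobj j x))
    (fun {_ x y} m => by
      rw [(conj_eqToHom_iff_heq' _ _ (hobj _ x) (hobj _ y).symm).2 (hmap m)]
      simp)
    (fun f x => by
      rw [hσ.nat_eq, hτ.nat_eq]
      simp [eqToHom_map])

lemma mod_ext {σ τ : Ps F G} {Γ Γ' : σ ⟶ τ}
    (h : ∀ (j : J) (x : F.obj j), (Γ.as.app j).toNatTrans.app x = (Γ'.as.app j).toNatTrans.app x) :
    Γ = Γ' :=
  Pseudofunctor.StrongTrans.homCategory.ext fun j => cat_hom₂_ext (h j)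

end PsCat

/-! ### Postcomposition with a pointwise equivalence -/

section Pointwise

variable {J : Type u₁} [Bicategory.{w₁, v₁} J]
  {W X Y : StrictPseudofunctor J Cat.{v₂, u₂}} (t : Ps X Y)

lemma faithful_postcomp (ht : ∀ j, (t.app j).toFunctor.Faithful) :
    (Bicategory.postcomp W.toPseudofunctor t).Faithful where
  map_injective {_ _} _ _ h := mod_ext fun j x =>
    (t.app j).toFunctor.map_injective congr((($h).as.app j).toNatTrans.app x)

lemma full_postcomp (ht : ∀ j, (t.app j).toFunctor.Faithful)
    (ht' : ∀ j, (t.app j).toFunctor.Full) :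
    (Bicategory.postcomp W.toPseudofunctor t).Full where
  map_surjective {σ τ} Γ := by
    let e (j : J) (x : W.obj j) : (σ.app j).toFunctor.obj x ⟶ (τ.app j).toFunctor.obj x :=
      (t.app j).toFunctor.preimage ((Γ.as.app j).toNatTrans.app x)
    have he (j : J) (x : W.obj j) : (t.app j).toFunctor.map (e j x) =
      (Γ.as.app j).toNatTrans.app x := (t.app j).toFunctor.map_preimage _
    refine ⟨modMk e (fun {j x y} m => ?_) (fun {i j} f x => ?_),
      mod_ext fun j x => he j x⟩
    · apply (t.app j).toFunctor.map_injective
      rw [Functor.map_comp, Functor.map_comp, he, he]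
      exact (Γ.as.app j).toNatTrans.naturality m
    · apply (t.app j).toFunctor.map_injective
      have h := modification_app Γ f x
      change _ ≫ (nat (τ ≫ t) f x).hom = (nat (σ ≫ t) f x).hom ≫ _ at h
      rw [nat_comp_trans, nat_comp_trans, ← he, ← he] at h
      rw [← cancel_mono (nat t f _).hom, Functor.map_comp, Functor.map_comp, Category.assoc,
        Category.assoc, nat_naturality]
      erw [h]
      exact Category.assoc _ _ _

/-- Pointwise inverses of `t` turn `τ` into a family of functors `σ j`; its structure 2-cells are
those of `τ` conjugated by those of `t`, lifted along the fully faithful components of `t`. -/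
lemma essSurj_postcomp (ht : ∀ j, (t.app j).toFunctor.IsEquivalence) :
    (Bicategory.postcomp W.toPseudofunctor t).EssSurj where
  mem_essImage τ := by
    let e (j : J) (x : W.obj j) : (t.app j).toFunctor.obj
        ((t.app j).toFunctor.objPreimage ((τ.app j).toFunctor.obj x)) ≅
          (τ.app j).toFunctor.obj x :=
      (t.app j).toFunctor.objObjPreimageIso _
    let σ (j : J) : W.obj j ⥤ X.obj j :=
      { obj x := (t.app j).toFunctor.objPreimage ((τ.app j).toFunctor.obj x)
        map {x y} m := (t.app j).toFunctor.preimage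
          ((e j x).hom ≫ (τ.app j).toFunctor.map m ≫ (e j y).inv)
        map_id x := (t.app j).toFunctor.map_injective (by simp)
        map_comp m n := (t.app j).toFunctor.map_injective (by simp) }
    have hσ {j : J} {x y : W.obj j} (m : x ⟶ y) :
        (t.app j).toFunctor.map ((σ j).map m) ≫ (e j y).hom =
          (e j x).hom ≫ (τ.app j).toFunctor.map m := by
      simp [σ]
    let s {i j : J} (f : i ⟶ j) (x : W.obj i) :
        (σ j).obj ((W.map f).toFunctor.obj x) ≅ (X.map f).toFunctor.obj ((σ i).obj x) :=
      (t.app j).toFunctor.preimageIso (e j _ ≪≫ nat τ f x ≪≫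
        (Y.map f).toFunctor.mapIso (e i x).symm ≪≫ (nat t f ((σ i).obj x)).symm)
    have hs {i j : J} (f : i ⟶ j) (x : W.obj i) :
        (t.app j).toFunctor.map (s f x).hom ≫ (nat t f ((σ i).obj x)).hom ≫
          (Y.map f).toFunctor.map (e i x).hom = (e j _).hom ≫ (nat τ f x).hom := by
      simp only [s, Functor.preimageIso_hom, Functor.map_preimage, Iso.trans_hom, Iso.symm_hom,
        Functor.mapIso_hom, Category.assoc, Iso.inv_hom_id_assoc, ← Functor.map_comp,
        Iso.inv_hom_id]
      simp
    -- morphisms into the image of `σ` are equal once they agree after `t` and `e`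
    have key {i j : J} (f : i ⟶ j) (x : W.obj i) {z : X.obj j}
        {m n : z ⟶ (X.map f).toFunctor.obj ((σ i).obj x)}
        (h : (t.app j).toFunctor.map m ≫ (nat t f ((σ i).obj x)).hom ≫
            (Y.map f).toFunctor.map (e i x).hom =
          (t.app j).toFunctor.map n ≫ (nat t f ((σ i).obj x)).hom ≫
            (Y.map f).toFunctor.map (e i x).hom) : m = n := by
      apply (t.app j).toFunctor.map_injective
      rw [← cancel_mono (nat t f ((σ i).obj x)).hom,
        ← cancel_mono ((Y.map f).toFunctor.map (e i x).hom)]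
      simpa using h
    have s_nat {i j : J} (f : i ⟶ j) {x y : W.obj i} (m : x ⟶ y) :
        (σ j).map ((W.map f).toFunctor.map m) ≫ (s f y).hom =
          (s f x).hom ≫ (X.map f).toFunctor.map ((σ i).map m) := by
      apply key
      rw [Functor.map_comp, Functor.map_comp, Category.assoc, Category.assoc, hs,
        reassoc_of% (hσ ((W.map f).toFunctor.map m)), nat_naturality τ f m,
        reassoc_of% (nat_naturality t f ((σ i).map m)), ← Functor.map_comp, hσ, Functor.map_comp,
        reassoc_of% (hs f x)]
    have s_map₂ {i j : J} {f g : i ⟶ j} (α : f ⟶ g) (x : W.obj i) :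
        (σ j).map ((W.map₂ α).toNatTrans.app x) ≫ (s g x).hom =
          (s f x).hom ≫ (X.map₂ α).toNatTrans.app ((σ i).obj x) := by
      apply key
      rw [Functor.map_comp, Functor.map_comp, Category.assoc, Category.assoc, hs,
        reassoc_of% (hσ ((W.map₂ α).toNatTrans.app x)), nat_map₂ τ α x,
        reassoc_of% (nat_map₂ t α ((σ i).obj x)), ← (Y.map₂ α).toNatTrans.naturality,
        reassoc_of% (hs f x)]
    have he {j : J} {x y : W.obj j} (h : x = y) : (e j x).hom =
        eqToHom (by rw [h]) ≫ (e j y).hom ≫ eqToHom (by rw [h]) := by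
      subst h; simp
    have s_id {j : J} (x : W.obj j) : (s (𝟙 j) x).hom = eqToHom (by rw [obj_id, obj_id]) := by
      apply key
      rw [hs, nat_id, nat_id, eqToHom_map, map_id_map, he (obj_id W x)]
      simp only [Category.assoc, eqToHom_trans, eqToHom_trans_assoc]
    have s_comp {i j k : J} (f : i ⟶ j) (g : j ⟶ k) (x : W.obj i) : (s (f ≫ g) x).hom =
        eqToHom (by rw [obj_comp]) ≫ (s g ((W.map f).toFunctor.obj x)).hom ≫
          (X.map g).toFunctor.map (s f x).hom ≫ eqToHom (by rw [obj_comp]) := by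
      apply key
      rw [hs, nat_comp, nat_comp, map_comp_map, he (obj_comp W f g x)]
      simp only [Functor.map_comp, eqToHom_map, Category.assoc,
        eqToHom_trans_assoc, eqToHom_refl, Category.id_comp]
      rw [reassoc_of% (nat_naturality t g (s f x).hom), ← Functor.map_comp_assoc,
        ← Functor.map_comp_assoc, Category.assoc, hs, Functor.map_comp_assoc,
        reassoc_of% (hs g ((W.map f).toFunctor.obj x))]
    let σ' : Ps W X := psMk (fun j => (σ j).toCatHom) s s_nat s_map₂ s_id s_comp
    refine ⟨σ', ⟨psIsoMk e (fun m => hσ m) (fun {i j} f x => ?_)⟩⟩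
    change _ = (nat (σ' ≫ t) f x).hom ≫ _
    rw [nat_comp_trans]
    exact ((Category.assoc _ _ _).trans (hs f x)).symm

/-- Pseudonatural transformations see pointwise equivalences as equivalences: the functor
`Ps(W, X) ⥤ Ps(W, Y)` induced by a pointwise equivalence is an equivalence. -/
lemma isEquivalence_postcomp (ht : ∀ j, (t.app j).toFunctor.IsEquivalence) :
    (Bicategory.postcomp W.toPseudofunctor t).IsEquivalence where
  faithful := faithful_postcomp t fun _ => inferInstance
  full := full_postcomp t (fun _ => inferInstance) fun _ => inferInstance
  essSurj := essSurj_postcomp t ht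

end Pointwise

/-! ### Comparison functors induced by cocones -/

section Cocones

variable {J : Type u₁} [Bicategory.{w₁, v₁} J] [Bicategory.Strict J]
  {C : Type u₂} [Bicategory.{w₂, v₂} C] [Bicategory.Strict C]

lemma whiskerLeft_whiskerLeft_eqToHom {a b c d : C} (f : a ⟶ b) (x : b ⟶ c) {u v : c ⟶ d}
    (β : u ⟶ v) : f ◁ x ◁ β ≫ eqToHom (Strict.assoc f x v).symm =
      eqToHom (Strict.assoc f x u).symm ≫ (f ≫ x) ◁ β := by
  rw [comp_whiskerLeft_eq]
  simp

/-- The functor `C(P, A) ⥤ Ps(C(D-, P), C(D-, A))`, `u ↦ C(D-, u)`. -/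
def homIntoPostFunctor (D : StrictPseudofunctor Jᵒᵖ C) (P A : C) :
    (P ⟶ A) ⥤ Ps (homInto D P) (homInto D A) where
  obj u := homIntoPost D u
  map β := homIntoPostMap D β
  map_id u := mod_ext fun _ x => whiskerLeft_id x u
  map_comp β γ := mod_ext fun _ x => whiskerLeft_comp x β γ

lemma homIntoPost_comp (D : StrictPseudofunctor Jᵒᵖ C) {P Q A : C} (m : P ⟶ Q) (u : Q ⟶ A) :
    homIntoPost D (m ≫ u) = homIntoPost D m ≫ homIntoPost D u :=
  ps_hext (fun _ x => (Strict.assoc x m u).symm) (fun {_ _ _} n => heq_whiskerRight_comp n m u)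
    (heq_nat_of_isTwoNatural (isTwoNatural_homIntoPost D _)
      ((isTwoNatural_homIntoPost D m).comp (isTwoNatural_homIntoPost D u))
      fun _ x => (Strict.assoc x m u).symm)

lemma homIntoPost_id (D : StrictPseudofunctor Jᵒᵖ C) (P : C) :
    homIntoPost D (𝟙 P) = 𝟙 (homInto D P).toPseudofunctor :=
  ps_hext (fun _ x => Strict.comp_id x) (fun {_ _ _} n => heq_whiskerRight_id n)
    (heq_nat_of_isTwoNatural (isTwoNatural_homIntoPost D _) (isTwoNatural_id _)
      fun _ x => Strict.comp_id x)

/-- Functoriality of `u ↦ C(D-, u)` in precomposition. -/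
def precompHomIntoPostIso (D : StrictPseudofunctor Jᵒᵖ C) {P Q : C} (m : P ⟶ Q) (A : C) :
    Bicategory.precomp A m ⋙ homIntoPostFunctor D P A ≅
      homIntoPostFunctor D Q A ⋙ Bicategory.precomp _ (homIntoPost D m) :=
  NatIso.ofComponents
    (fun u => psIsoOfEq (isTwoNatural_homIntoPost D (m ≫ u))
      ((isTwoNatural_homIntoPost D m).comp (isTwoNatural_homIntoPost D u))
      (fun _ x => (Strict.assoc x m u).symm) (fun {_ _ _} n => heq_whiskerRight_comp n m u))
    (fun β => mod_ext fun _ x => whiskerLeft_whiskerLeft_eqToHom x m β)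

/-- Naturality of `C(f-, A)` in `A`. -/
def homIntoPostMapIso {D E : StrictPseudofunctor Jᵒᵖ C} (f : TwoNat D E) (P A : C) :
    homIntoPostFunctor E P A ⋙ Bicategory.postcomp _ (homIntoMap f A) ≅
      homIntoPostFunctor D P A ⋙ Bicategory.precomp _ (homIntoMap f P) :=
  NatIso.ofComponents
    (fun u => psIsoOfEq ((isTwoNatural_homIntoPost E u).comp (isTwoNatural_homIntoMap f A))
      ((isTwoNatural_homIntoMap f P).comp (isTwoNatural_homIntoPost D u))
      (fun _ x => (Strict.assoc _ x u).symm)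
      (fun {_ _ _} n => (heq_whisker_assoc _ n u).symm))
    (fun β => mod_ext fun _ x => whiskerLeft_whiskerLeft_eqToHom _ x β)

/-- A pointwise equivalence `f : D ⟶ E` induces equivalences between the categories of
pseudonatural cocones under `E` and under `D`. -/
lemma isEquivalence_postcomp_homIntoMap {W : StrictPseudofunctor J Cat.{w₂, v₂}}
    {D E : StrictPseudofunctor Jᵒᵖ C} {f : TwoNat D E}
    (hf : ∀ j : J, IsEquiv₁ (f.obj.app (op j))) (A : C) :
    (Bicategory.postcomp W.toPseudofunctor (homIntoMap f A)).IsEquivalence :=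
  isEquivalence_postcomp _ fun j => (hf j).isEquivalence_precomp A

end Cocones

/-! ### Comparison 1-cells between colimits -/

namespace WeightedColimit

variable {J : Type u₁} [Bicategory.{w₁, v₁} J] [Bicategory.Strict J]
  {C : Type u₂} [Bicategory.{w₂, v₂} C] [Bicategory.Strict C]
  {V W : StrictPseudofunctor J Cat.{w₂, v₂}} {D E : StrictPseudofunctor Jᵒᵖ C}

/-- Precomposition with `W⋆f` corresponds to postcomposition with `C(f-, A)`. -/
noncomputable def mapDiagramIso (f : TwoNat D E) (c : WeightedColimit W D)
    (c' : WeightedColimit W E) (A : C) :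
    Bicategory.precomp A (mapDiagram f c c') ⋙ inducedPs c.cocone.obj A ≅
      inducedPs c'.cocone.obj A ⋙ Bicategory.postcomp _ (homIntoMap f A) :=
  calc
    Bicategory.precomp A (mapDiagram f c c') ⋙ inducedPs c.cocone.obj A
    _ ≅ (homIntoPostFunctor D c'.pt A ⋙ Bicategory.precomp _ (homIntoPost D _)) ⋙
          Bicategory.precomp _ c.cocone.obj :=
        Functor.isoWhiskerRight (precompHomIntoPostIso D (mapDiagram f c c') A)
          (Bicategory.precomp _ c.cocone.obj)
    _ ≅ homIntoPostFunctor D c'.pt A ⋙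
          Bicategory.precomp _ (c.cocone.obj ≫ homIntoPost D (mapDiagram f c c')) :=
        Functor.isoWhiskerLeft (homIntoPostFunctor D c'.pt A)
          (associatorNatIsoRight c.cocone.obj (homIntoPost D (mapDiagram f c c')) _).symm
    _ ≅ homIntoPostFunctor D c'.pt A ⋙
          Bicategory.precomp _ (c'.cocone.obj ≫ homIntoMap f c'.pt) :=
        Functor.isoWhiskerLeft _ ((precomposing _ _ _).mapIso (eqToIso (c.fac _)))
    _ ≅ (homIntoPostFunctor D c'.pt A ⋙ Bicategory.precomp _ (homIntoMap f c'.pt)) ⋙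
          Bicategory.precomp _ c'.cocone.obj :=
        Functor.isoWhiskerLeft (homIntoPostFunctor D c'.pt A)
          (associatorNatIsoRight c'.cocone.obj (homIntoMap f c'.pt) _)
    _ ≅ (homIntoPostFunctor E c'.pt A ⋙ Bicategory.postcomp _ (homIntoMap f A)) ⋙
          Bicategory.precomp _ c'.cocone.obj :=
        Functor.isoWhiskerRight (homIntoPostMapIso f c'.pt A).symm _
    _ ≅ inducedPs c'.cocone.obj A ⋙ Bicategory.postcomp _ (homIntoMap f A) :=
        Functor.isoWhiskerLeft (homIntoPostFunctor E c'.pt A)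
          (associatorNatIsoMiddle c'.cocone.obj (homIntoMap f A)).symm

/-- Precomposition with `q⋆D` corresponds to precomposition with `q`. -/
noncomputable def mapWeightIso (q : TwoNat V W) (c : WeightedColimit V D)
    (c' : WeightedColimit W D) (A : C) :
    Bicategory.precomp A (mapWeight q c c') ⋙ inducedPs c.cocone.obj A ≅
      inducedPs c'.cocone.obj A ⋙ Bicategory.precomp _ q.obj :=
  calc
    Bicategory.precomp A (mapWeight q c c') ⋙ inducedPs c.cocone.obj A
    _ ≅ (homIntoPostFunctor D c'.pt A ⋙ Bicategory.precomp _ (homIntoPost D _)) ⋙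
          Bicategory.precomp _ c.cocone.obj :=
        Functor.isoWhiskerRight (precompHomIntoPostIso D (mapWeight q c c') A)
          (Bicategory.precomp _ c.cocone.obj)
    _ ≅ homIntoPostFunctor D c'.pt A ⋙
          Bicategory.precomp _ (c.cocone.obj ≫ homIntoPost D (mapWeight q c c')) :=
        Functor.isoWhiskerLeft (homIntoPostFunctor D c'.pt A)
          (associatorNatIsoRight c.cocone.obj (homIntoPost D (mapWeight q c c')) _).symm
    _ ≅ homIntoPostFunctor D c'.pt A ⋙ Bicategory.precomp _ (q.obj ≫ c'.cocone.obj) :=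
        Functor.isoWhiskerLeft _ ((precomposing _ _ _).mapIso (eqToIso (c.fac _)))
    _ ≅ inducedPs c'.cocone.obj A ⋙ Bicategory.precomp _ q.obj :=
        Functor.isoWhiskerLeft (homIntoPostFunctor D c'.pt A)
          (associatorNatIsoRight q.obj c'.cocone.obj _)

end WeightedColimit

/-! ### Categories of cocones and the pseudomorphism classifier -/

section

variable {X : Type u₁} [Category.{v₁} X] {Y : Type u₂} [Category.{v₂} Y]

lemma IsIsoOfCategories.isEquivalence {F : X ⥤ Y} (hF : IsIsoOfCategories F) : F.IsEquivalence :=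
  have := hF.1
  have := hF.2.1
  { essSurj := ⟨fun y => by obtain ⟨x, rfl⟩ := hF.2.2.2 y; exact ⟨x, ⟨Iso.refl _⟩⟩⟩ }

end

section ClassifierColimit

variable {J : Type u₁} [Bicategory.{w₁, v₁} J] [Bicategory.Strict J]
  {C : Type u₂} [Bicategory.{w₂, v₂} C] [Bicategory.Strict C]
  {W : StrictPseudofunctor J Cat.{w₂, v₂}} {D : StrictPseudofunctor Jᵒᵖ C}

/-- A colimit weighted by the pseudomorphism classifier of `W` represents pseudonatural
cocones. -/
lemma isIsoOfCategories_inducedPs_unit (K : PseudomorphismClassifier W)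
    (c : WeightedColimit K.obj D) (A : C) :
    IsIsoOfCategories (inducedPs (K.unit ≫ c.cocone.obj) A) := by
  have hc := c.isColimit A
  have hK := K.universal (homInto D A)
  have e : inducedTwoNat c.cocone A ⋙ precompUnit K.unit (homInto D A) ≅
      inducedPs (K.unit ≫ c.cocone.obj) A :=
    Functor.isoWhiskerLeft (homIntoPostFunctor D c.pt A)
      (associatorNatIsoRight K.unit c.cocone.obj _).symm
  have := hc.1
  have := hc.2.1
  have := hK.1
  have := hK.2.1
  refine ⟨Functor.Full.of_iso e, Functor.Faithful.of_iso e, ?_⟩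
  have h : (inducedPs (K.unit ≫ c.cocone.obj) A).obj =
      (inducedTwoNat c.cocone A ⋙ precompUnit K.unit (homInto D A)).obj :=
    funext fun u => ps_assoc _ _ _
  rw [h]
  exact hK.2.2.comp hc.2.2

/-- Under the isomorphism between 2-natural cocones on `QW` and pseudonatural cocones on `W`,
precomposition with `q_W⋆D` becomes the comparison functor of the colimit `W⋆D`. -/
noncomputable def mapWeightCounitIso (K : PseudomorphismClassifier W) (c : WeightedColimit K.obj D)
    (c' : WeightedColimit W D) (A : C) :
    Bicategory.precomp A (WeightedColimit.mapWeight K.counit c c') ⋙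
      inducedPs (K.unit ≫ c.cocone.obj) A ≅ inducedPs c'.cocone.obj A :=
  calc
    Bicategory.precomp A (WeightedColimit.mapWeight K.counit c c') ⋙
      inducedPs (K.unit ≫ c.cocone.obj) A
    _ ≅ (Bicategory.precomp A (WeightedColimit.mapWeight K.counit c c') ⋙
          inducedPs c.cocone.obj A) ⋙ Bicategory.precomp _ K.unit :=
        Functor.isoWhiskerLeft (Bicategory.precomp A (WeightedColimit.mapWeight K.counit c c') ⋙
          homIntoPostFunctor D c.pt A) (associatorNatIsoRight K.unit c.cocone.obj _)
    _ ≅ (inducedPs c'.cocone.obj A ⋙ Bicategory.precomp _ K.counit.obj) ⋙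
          Bicategory.precomp _ K.unit :=
        Functor.isoWhiskerRight (WeightedColimit.mapWeightIso K.counit c c' A) _
    _ ≅ inducedPs c'.cocone.obj A ⋙ Bicategory.precomp _ (K.unit ≫ K.counit.obj) :=
        Functor.isoWhiskerLeft (inducedPs c'.cocone.obj A)
          (associatorNatIsoRight K.unit K.counit.obj _).symm
    _ ≅ inducedPs c'.cocone.obj A ⋙ Bicategory.precomp _ (𝟙 W.toPseudofunctor) :=
        Functor.isoWhiskerLeft _ ((precomposing _ _ _).mapIso (eqToIso K.unit_counit))
    _ ≅ inducedPs c'.cocone.obj A ⋙ 𝟭 _ :=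
        Functor.isoWhiskerLeft _ (leftUnitorNatIso _ _)
    _ ≅ inducedPs c'.cocone.obj A := Functor.rightUnitor _

/-- A colimit is a bicolimit exactly when the comparison from the colimit weighted by the
pseudomorphism classifier is an equivalence. -/
theorem isBicolimit_iff_isEquiv₁_mapWeight_counit (K : PseudomorphismClassifier W)
    (c : WeightedColimit K.obj D) (c' : WeightedColimit W D) :
    IsBicolimit c'.cocone.obj ↔ IsEquiv₁ (WeightedColimit.mapWeight K.counit c c') := by
  have hK (A : C) : (inducedPs (K.unit ≫ c.cocone.obj) A).IsEquivalence :=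
    (isIsoOfCategories_inducedPs_unit K c A).isEquivalence
  refine ⟨fun h => isEquiv₁_of_isEquivalence_precomp fun A => ?_, fun h A => ?_⟩
  · have := h A
    have := Functor.isEquivalence_of_iso (mapWeightCounitIso K c c' A).symm
    exact Functor.isEquivalence_of_comp_right _ (inducedPs (K.unit ≫ c.cocone.obj) A)
  · have := h.isEquivalence_precomp A
    exact Functor.isEquivalence_of_iso (mapWeightCounitIso K c c' A)

end ClassifierColimit

/-! ### The Yoneda lemma for pseudonatural transformations out of a representable -/

section Yoneda

variable {J : Type u₁} [Bicategory.{w₁, v₁} J] [Bicategory.Strict J]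

/-- The representable 2-functor `J(j, -)`. -/
abbrev representable (j : J) : StrictPseudofunctor J Cat.{w₁, v₁} :=
  homFrom j (StrictPseudofunctor.id J)

variable {F G : StrictPseudofunctor J Cat.{w₁, v₁}}

lemma conj_comp_eqToHom {X : Type u₁} [Category.{v₁} X] {a b c d : X} (h₁ : a = b) (m : b ⟶ c)
    (h₂ : c = d) (h₃ : d = c) : (eqToHom h₁ ≫ m ≫ eqToHom h₂) ≫ eqToHom h₃ = eqToHom h₁ ≫ m := by
  simp

lemma conj_comp_comp_eqToHom {X : Type u₁} [Category.{v₁} X] {a b c d e : X} (h₁ : a = b)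
    (m : b ⟶ c) (n : c ⟶ d) (h₂ : d = e) (h₃ : e = d) :
    (eqToHom h₁ ≫ m ≫ n ≫ eqToHom h₂) ≫ eqToHom h₃ = (eqToHom h₁ ≫ m) ≫ n := by
  simp

/-- The functor `J(j, k) ⥤ F k`, `h ↦ F h x`. -/
def yonedaApp {j : J} (x : F.obj j) (k : J) : (j ⟶ k) ⥤ F.obj k where
  obj h := (F.map h).toFunctor.obj x
  map α := (F.map₂ α).toNatTrans.app x
  map_id h := by rw [F.map₂_id]; rfl
  map_comp α β := by rw [F.map₂_comp]; rfl

/-- The 2-natural transformation `J(j, -) ⟶ F`, `h ↦ F h x`, named by an object `x` of `F j`. -/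
def yoneda {j : J} (x : F.obj j) : Ps (representable j) F :=
  mkTwoNatural (fun k => (yonedaApp x k).toCatHom)
    (fun g => Cat.ext (CategoryTheory.Functor.ext (fun h => obj_comp F h g x)
      (fun _ _ α => map₂_whiskerRight_app F α g x)))
    (fun {_ _ _ _} α => by
      refine cat_hom₂_ext fun h => (?_ : _ = _).trans (conj_app _ _ _ h).symm
      exact map₂_whiskerLeft_app F h α x)

lemma isTwoNatural_yoneda {j : J} (x : F.obj j) :
    IsTwoNatural (representable j) F (yoneda x) :=
  fun _ _ _ => ⟨_, rfl⟩

/-- The modification named by a morphism of `F j`. -/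
def yonedaMap {j : J} {x y : F.obj j} (m : x ⟶ y) : yoneda x ⟶ yoneda y :=
  modMk (fun _ h => (F.map h).toFunctor.map m)
    (fun α => ((F.map₂ α).toNatTrans.naturality m).symm)
    (fun f h => by
      rw [(isTwoNatural_yoneda x).nat_eq, (isTwoNatural_yoneda y).nat_eq]
      refine (congrArg (· ≫ _) (map_comp_map F h f m)).trans ?_
      exact conj_comp_eqToHom _ _ _ _)

/-- The Yoneda correspondence is natural up to the structure 2-cells of `σ`. -/
def yonedaCompIso {j : J} (x : F.obj j) (σ : Ps F G) :
    yoneda x ≫ σ ≅ yoneda ((σ.app j).toFunctor.obj x) :=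
  psIsoMk (fun _ h => nat σ h x) (fun α => nat_map₂ σ α x) (fun f h => by
    rw [(isTwoNatural_yoneda _).nat_eq, nat_comp_trans, (isTwoNatural_yoneda _).nat_eq]
    refine (congrArg (· ≫ _) (nat_comp σ h f x)).trans ?_
    rw [eqToHom_map]
    exact conj_comp_comp_eqToHom _ _ _ _ _)

/-- For 2-natural `σ` the isomorphism `yonedaCompIso` is an equality. -/
lemma yoneda_comp {j : J} (x : F.obj j) {σ : Ps F G} (hσ : IsTwoNatural F G σ) :
    yoneda x ≫ σ = yoneda ((σ.app j).toFunctor.obj x) :=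
  ps_ext_of_modification (yonedaCompIso x σ).hom fun _ h => ⟨_, hσ.nat_eq h x⟩

/-- The Yoneda correspondence is natural in `j`. -/
lemma homFromPre_yoneda {i j : J} (f : i ⟶ j) (x : F.obj i) :
    homFromPre f (StrictPseudofunctor.id J) ≫ yoneda x = yoneda ((F.map f).toFunctor.obj x) :=
  ps_hext (fun _ h => obj_comp F f h x)
    (fun {_ _ _} α => (heq_of_eq (map₂_whiskerLeft_app F f α x)).trans (heq_conj _ _ _))
    (heq_nat_of_isTwoNatural ((isTwoNatural_homFromPre f _).comp (isTwoNatural_yoneda x))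
      (isTwoNatural_yoneda _) fun _ h => obj_comp F f h x)

/-- The identity of `J(j, -)` is named by the identity of `j`. -/
lemma yoneda_id (j : J) :
    yoneda (F := representable j) (𝟙 j) = 𝟙 (representable j).toPseudofunctor :=
  ps_hext (fun _ h => Strict.id_comp h) (fun {_ _ _} α => heq_id_whiskerLeft α)
    (heq_nat_of_isTwoNatural (isTwoNatural_yoneda _) (isTwoNatural_id _)
      fun _ h => Strict.id_comp h)

end Yoneda

/-! ### Objects representing pseudonatural cocones -/

section Representing

variable {J : Type u₁} [Bicategory.{w₂, v₂} J] [Bicategory.Strict J]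
  {C : Type u₂} [Bicategory.{w₂, v₂} C] [Bicategory.Strict C]

/-- Objects `pt j` representing the categories `Ps(J(j, -), C(D-, A))` of pseudonatural cocones.
They are the values of the pseudomorphism classifier `QD` of the diagram `D`. -/
structure DiagramClassifier (D : StrictPseudofunctor Jᵒᵖ C) where
  pt : J → C
  unit (j : J) : Ps (representable j) (homInto D (pt j))
  universal (j : J) (A : C) : IsIsoOfCategories (inducedPs (unit j) A)

namespace DiagramClassifier

variable {D : StrictPseudofunctor Jᵒᵖ C} (R : DiagramClassifier D)

/-- The legs of the universal pseudonatural cocone under `D` with vertex `R.pt j`. -/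
def leg {j k : J} (h : j ⟶ k) : D.obj (op k) ⟶ R.pt j :=
  ((R.unit j).app k).toFunctor.obj h

/-- The action of the universal cocone on 2-cells. -/
def legMap {j k : J} {h h' : j ⟶ k} (α : h ⟶ h') : R.leg h ⟶ R.leg h' :=
  ((R.unit j).app k).toFunctor.map α

/-- The 1-cell out of `R.pt j` corresponding to a pseudonatural cocone. -/
noncomputable def desc {j : J} {A : C} (σ : Ps (representable j) (homInto D A)) : R.pt j ⟶ A :=
  ((R.universal j A).2.2.2 σ).choose

lemma fac {j : J} {A : C} (σ : Ps (representable j) (homInto D A)) :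
    R.unit j ≫ homIntoPost D (R.desc σ) = σ :=
  ((R.universal j A).2.2.2 σ).choose_spec

lemma hom_ext {j : J} {A : C} {s t : R.pt j ⟶ A}
    (h : R.unit j ≫ homIntoPost D s = R.unit j ≫ homIntoPost D t) : s = t :=
  (R.universal j A).2.2.1 h

section

variable {j : J} {A : C} {s : R.pt j ⟶ A} {σ : Ps (representable j) (homInto D A)}
  (hs : R.unit j ≫ homIntoPost D s = σ)
include hs

lemma leg_comp {k : J} (h : j ⟶ k) : R.leg h ≫ s = (σ.app k).toFunctor.obj h := by
  subst hs; rfl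

lemma legMap_whiskerRight {k : J} {h h' : j ⟶ k} (α : h ⟶ h') :
    R.legMap α ▷ s ≍ (σ.app k).toFunctor.map α := by
  subst hs; rfl

end

/-- 2-cells out of `R.pt j` are determined by their whiskerings with the legs. -/
lemma leg_heq_ext {j : J} {A : C} {s t s' t' : R.pt j ⟶ A} (hs : s = s') (ht : t = t')
    {β : s ⟶ t} {β' : s' ⟶ t'} (h : ∀ {k : J} (h : j ⟶ k), R.leg h ◁ β ≍ R.leg h ◁ β') :
    β ≍ β' := by
  subst hs ht
  have := (R.universal j A).2.1
  exact heq_of_eq ((inducedPs (R.unit j) A).map_injective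
    (mod_ext fun k l => eq_of_heq (h (k := k) l)))

/-- The 2-cell between 1-cells out of `R.pt j` corresponding to a modification of cocones. -/
lemma exists_hom₂ {j : J} {A : C} {s t : R.pt j ⟶ A} {σ τ : Ps (representable j) (homInto D A)}
    (hs : R.unit j ≫ homIntoPost D s = σ) (ht : R.unit j ≫ homIntoPost D t = τ) (Γ : σ ⟶ τ) :
    ∃ β : s ⟶ t, ∀ {k : J} (h : j ⟶ k), R.leg h ◁ β ≍ (Γ.as.app k).toNatTrans.app h := by
  have := (R.universal j A).1
  subst hs ht
  obtain ⟨β, hβ⟩ := (inducedPs (R.unit j) A).map_surjective Γ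
  exact ⟨β, fun {k} h => heq_of_eq congr((($hβ).as.app k).toNatTrans.app h)⟩

/-- The invertible 2-cell between 1-cells out of `R.pt j` corresponding to an invertible
modification of cocones. -/
lemma exists_iso {j : J} {A : C} {s t : R.pt j ⟶ A} {σ τ : Ps (representable j) (homInto D A)}
    (hs : R.unit j ≫ homIntoPost D s = σ) (ht : R.unit j ≫ homIntoPost D t = τ) (Γ : σ ≅ τ) :
    ∃ e : s ≅ t, ∀ {k : J} (h : j ⟶ k), R.leg h ◁ e.hom ≍ (Γ.hom.as.app k).toNatTrans.app h := by
  have := (R.universal j A).1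
  have := (R.universal j A).2.1
  subst hs ht
  refine ⟨(inducedPs (R.unit j) A).preimageIso Γ, fun {k} h => heq_of_eq ?_⟩
  have h' := (inducedPs (R.unit j) A).map_preimage Γ.hom
  exact congr((($h').as.app k).toNatTrans.app h)

end DiagramClassifier

end Representing

/-! ### The pseudomorphism classifier of a diagram -/

section Classifier

variable {J : Type u₁} [Bicategory.{w₂, v₂} J] [Bicategory.Strict J]
  {C : Type u₂} [Bicategory.{w₂, v₂} C] [Bicategory.Strict C]

lemma homFromPre_id (j : J) : homFromPre (𝟙 j) (StrictPseudofunctor.id J) =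
    𝟙 (representable j).toPseudofunctor :=
  ps_hext (fun _ h => Strict.id_comp h) (fun {_ _ _} α => heq_id_whiskerLeft α)
    (heq_nat_of_isTwoNatural (isTwoNatural_homFromPre _ _) (isTwoNatural_id _)
      fun _ h => Strict.id_comp h)

lemma homFromPre_comp {i j k : J} (f : i ⟶ j) (g : j ⟶ k) :
    homFromPre (f ≫ g) (StrictPseudofunctor.id J) =
      homFromPre g (StrictPseudofunctor.id J) ≫ homFromPre f (StrictPseudofunctor.id J) :=
  ps_hext (fun _ h => Strict.assoc f g h) (fun {_ _ _} α => heq_comp_whiskerLeft f g α)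
    (heq_nat_of_isTwoNatural (isTwoNatural_homFromPre _ _)
      ((isTwoNatural_homFromPre g _).comp (isTwoNatural_homFromPre f _))
      fun _ h => Strict.assoc f g h)

lemma op2_eqToHom {i j : J} {f g : i ⟶ j} (h : f = g) :
    op2 (eqToHom h) = eqToHom (congrArg Quiver.Hom.op h) := by
  subst h; rfl

/-- The 1-cell dual of a 2-category is a 2-category. -/
instance strictOpposite : Bicategory.Strict Jᵒᵖ where
  id_comp f := congrArg Quiver.Hom.op (Strict.comp_id f.unop)
  comp_id f := congrArg Quiver.Hom.op (Strict.id_comp f.unop)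
  assoc f g h := congrArg Quiver.Hom.op (Strict.assoc h.unop g.unop f.unop).symm
  leftUnitor_eqToIso f := Iso.ext (by
    change op2 (ρ_ f.unop).hom = _
    rw [Strict.rightUnitor_eqToIso]
    exact op2_eqToHom (Strict.comp_id f.unop))
  rightUnitor_eqToIso f := Iso.ext (by
    change op2 (λ_ f.unop).hom = _
    rw [Strict.leftUnitor_eqToIso]
    exact op2_eqToHom (Strict.id_comp f.unop))
  associator_eqToIso f g h := Iso.ext (by
    change op2 (α_ h.unop g.unop f.unop).inv = _
    rw [Strict.associator_eqToIso]
    exact op2_eqToHom (Strict.assoc h.unop g.unop f.unop).symm)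

/-- The identity of `D j` as an object of `C(D j, D j)`. -/
def idObj (D : StrictPseudofunctor Jᵒᵖ C) (j : J) : (homInto D (D.obj (op j))).obj j :=
  𝟙 (D.obj (op j))

namespace DiagramClassifier

variable {D : StrictPseudofunctor Jᵒᵖ C} (R : DiagramClassifier D)

/-- The action of the classifier on 1-cells, induced by the Yoneda embedding. -/
noncomputable def map {i j : J} (f : i ⟶ j) : R.pt j ⟶ R.pt i :=
  R.desc (homFromPre f (StrictPseudofunctor.id J) ≫ R.unit i)

lemma unit_map {i j : J} (f : i ⟶ j) : R.unit j ≫ homIntoPost D (R.map f) =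
    homFromPre f (StrictPseudofunctor.id J) ≫ R.unit i :=
  R.fac _

lemma unit_map_comp {i j : J} (f : i ⟶ j) {A : C} {s : R.pt i ⟶ A}
    {σ : Ps (representable i) (homInto D A)} (hs : R.unit i ≫ homIntoPost D s = σ) :
    R.unit j ≫ homIntoPost D (R.map f ≫ s) =
      homFromPre f (StrictPseudofunctor.id J) ≫ σ := by
  rw [homIntoPost_comp, ← ps_assoc, unit_map, ps_assoc, hs]

lemma leg_map {i j k : J} (f : i ⟶ j) (h : j ⟶ k) : R.leg h ≫ R.map f = R.leg (f ≫ h) :=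
  R.leg_comp (R.unit_map f) h

lemma legMap_heq {j k : J} {g g' h h' : j ⟶ k} (hg : g = g') (hh : h = h') {α : g ⟶ h}
    {α' : g' ⟶ h'} (hα : α ≍ α') : R.legMap α ≍ R.legMap α' := by
  subst hg hh; rw [eq_of_heq hα]

lemma legMap_id {j k : J} (h : j ⟶ k) : R.legMap (𝟙 h) = 𝟙 _ :=
  ((R.unit j).app k).toFunctor.map_id h

lemma legMap_comp {j k : J} {f g h : j ⟶ k} (α : f ⟶ g) (β : g ⟶ h) :
    R.legMap (α ≫ β) = R.legMap α ≫ R.legMap β :=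
  ((R.unit j).app k).toFunctor.map_comp α β

lemma map_id (j : J) : R.map (𝟙 j) = 𝟙 (R.pt j) := by
  apply R.hom_ext
  rw [unit_map, homFromPre_id, ps_id_comp, homIntoPost_id]
  exact (ps_comp_id _).symm

lemma map_comp {i j k : J} (f : i ⟶ j) (g : j ⟶ k) : R.map (f ≫ g) = R.map g ≫ R.map f := by
  apply R.hom_ext
  rw [unit_map, R.unit_map_comp g (R.unit_map f), homFromPre_comp, ps_assoc]

lemma exists_map₂ {i j : J} {f g : i ⟶ j} (α : f ⟶ g) :
    ∃ β : R.map f ⟶ R.map g, ∀ {k : J} (h : j ⟶ k), R.leg h ◁ β ≍ R.legMap (α ▷ h) :=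
  R.exists_hom₂ (R.unit_map f) (R.unit_map g)
    (homFromPreMap α (StrictPseudofunctor.id J) ▷ R.unit i)

/-- The action of the classifier on 2-cells, induced by the Yoneda embedding. -/
noncomputable def map₂ {i j : J} {f g : i ⟶ j} (α : f ⟶ g) : R.map f ⟶ R.map g :=
  (R.exists_map₂ α).choose

lemma leg_map₂ {i j k : J} {f g : i ⟶ j} (α : f ⟶ g) (h : j ⟶ k) :
    R.leg h ◁ R.map₂ α ≍ R.legMap (α ▷ h) :=
  (R.exists_map₂ α).choose_spec h

lemma leg_map₂_whiskerRight {i j k : J} {f g : i ⟶ j} (α : f ⟶ g) (h : j ⟶ k) {A : C}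
    {s : R.pt i ⟶ A} {σ : Ps (representable i) (homInto D A)}
    (hs : R.unit i ≫ homIntoPost D s = σ) :
    R.leg h ◁ R.map₂ α ▷ s ≍ (σ.app k).toFunctor.map (α ▷ h) :=
  ((heq_whisker_assoc _ _ _).symm.trans (heq_whiskerRight (R.leg_map f h) (R.leg_map g h) rfl
    (R.leg_map₂ α h))).trans (R.legMap_whiskerRight hs _)

lemma leg_whiskerLeft_map {i j k : J} (f : i ⟶ j) (h : j ⟶ k) {A : C} {s t : R.pt i ⟶ A}
    (β : s ⟶ t) : R.leg h ◁ R.map f ◁ β ≍ R.leg (f ≫ h) ◁ β :=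
  (heq_comp_whiskerLeft _ _ _).symm.trans (heq_whiskerLeft (R.leg_map f h) rfl rfl HEq.rfl)

/-- The pseudomorphism classifier of `D` as a 2-functor. -/
noncomputable def diagram : StrictPseudofunctor Jᵒᵖ C :=
  StrictPseudofunctor.mk''
    { obj x := R.pt x.unop
      map f := R.map f.unop
      map₂ α := R.map₂ α.unop2
      map₂_id f := by
        refine eq_of_heq (R.leg_heq_ext rfl rfl fun h => (R.leg_map₂ _ h).trans ?_)
        rw [unop2_id, id_whiskerRight, legMap_id, Bicategory.whiskerLeft_id, leg_map]
      map₂_comp {_ _ f g e} α β := by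
        refine eq_of_heq (R.leg_heq_ext rfl rfl fun h => (R.leg_map₂ _ h).trans ?_)
        rw [unop2_comp, comp_whiskerRight, legMap_comp, Bicategory.whiskerLeft_comp]
        exact heq_comp (R.leg_map f.unop h).symm (R.leg_map g.unop h).symm
          (R.leg_map e.unop h).symm (R.leg_map₂ _ h).symm (R.leg_map₂ _ h).symm
      map_id x := R.map_id x.unop
      map_comp f g := R.map_comp g.unop f.unop
      map₂_whisker_left {x y z} f g g' η := by
        refine (conj_eqToHom_iff_heq' _ _ _ _).2 (R.leg_heq_ext (R.map_comp g.unop f.unop)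
          (R.map_comp g'.unop f.unop) fun h => (R.leg_map₂ _ h).trans ?_)
        refine HEq.trans ?_ ((R.leg_whiskerLeft_map f.unop h _).trans (R.leg_map₂ _ _)).symm
        exact R.legMap_heq (Strict.assoc _ _ _) (Strict.assoc _ _ _)
          (heq_whiskerRight_comp η.unop2 f.unop h).symm
      map₂_whisker_right {x y z f f'} η g := by
        refine (conj_eqToHom_iff_heq' _ _ _ _).2 (R.leg_heq_ext (R.map_comp g.unop f.unop)
          (R.map_comp g.unop f'.unop) fun h => (R.leg_map₂ _ h).trans ?_)
        refine HEq.trans ?_ (R.leg_map₂_whiskerRight _ h (R.unit_map g.unop)).symm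
        exact R.legMap_heq (Strict.assoc _ _ _) (Strict.assoc _ _ _)
          (heq_whisker_assoc g.unop η.unop2 h) }

/-! ### The counit of the classifier of a diagram -/

/-- The 1-cell `q_j : QD j ⟶ D j` named by the identity of `D j`. -/
noncomputable def counitApp (j : J) : R.pt j ⟶ D.obj (op j) :=
  R.desc (yoneda (idObj D j))

lemma unit_counitApp (j : J) : R.unit j ≫ homIntoPost D (R.counitApp j) =
    yoneda (idObj D j) :=
  R.fac _

lemma unit_counitApp_comp {j : J} {A : C} (s : D.obj (op j) ⟶ A) :
    R.unit j ≫ homIntoPost D (R.counitApp j ≫ s) = yoneda (F := homInto D A) s := by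
  rw [homIntoPost_comp, ← ps_assoc, unit_counitApp, yoneda_comp _ (isTwoNatural_homIntoPost D s)]
  exact congrArg (yoneda (F := homInto D A)) (Strict.id_comp s)

lemma leg_counitApp {j k : J} (h : j ⟶ k) : R.leg h ≫ R.counitApp j = D.map h.op :=
  (R.leg_comp (R.unit_counitApp j) h).trans (Strict.comp_id _)

lemma leg_whiskerLeft_counitApp {j k : J} (h : j ⟶ k) {A : C} {s t : D.obj (op j) ⟶ A}
    (β : s ⟶ t) : R.leg h ◁ R.counitApp j ◁ β ≍ D.map h.op ◁ β :=
  (heq_comp_whiskerLeft _ _ _).symm.trans (heq_whiskerLeft (R.leg_counitApp h) rfl rfl HEq.rfl)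

lemma map_counitApp {x y : Jᵒᵖ} (f : x ⟶ y) :
    R.map f.unop ≫ R.counitApp y.unop = R.counitApp x.unop ≫ D.map f := by
  refine R.hom_ext (((R.unit_map_comp f.unop (R.unit_counitApp y.unop)).trans ?_).trans
    (R.unit_counitApp_comp (D.map f)).symm)
  rw [homFromPre_yoneda]
  exact congrArg (yoneda (F := homInto D (D.obj y))) (Strict.comp_id (D.map f))

/-- The counit `q : QD ⟶ D` of the classifier, a 2-natural transformation. -/
noncomputable def counit : TwoNat R.diagram D where
  obj := mkTwoNatural (fun x => R.counitApp x.unop) (fun f => R.map_counitApp f)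
    (fun {x y f g} α => by
      refine (conj_eqToHom_iff_heq' _ _ _ _).2 (R.leg_heq_ext (R.map_counitApp f)
        (R.map_counitApp g) fun h => ?_)
      refine (R.leg_map₂_whiskerRight α.unop2 h (R.unit_counitApp y.unop)).trans
        (HEq.trans ?_ (R.leg_whiskerLeft_counitApp h (D.map₂ α)).symm)
      exact (heq_whiskerRight_id (D.map₂ (h.op ◁ α))).trans (heq_map₂_whiskerLeft D h.op α))
  property _ _ _ := ⟨_, rfl⟩

/-- Each `q_j` is an equivalence: its inverse is the leg at the identity, and the universal cocone
is isomorphic to the one named by this leg. -/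
lemma isEquiv₁_counitApp (j : J) : IsEquiv₁ (R.counitApp j) := by
  have h₁ : R.leg (𝟙 j) ≫ R.counitApp j = 𝟙 _ := (R.leg_counitApp (𝟙 j)).trans (D.map_id _)
  have := (R.universal j (R.pt j)).1
  have := (R.universal j (R.pt j)).2.1
  have h₂ : R.unit j ≅ yoneda (F := homInto D (R.pt j)) (R.leg (𝟙 j)) :=
    eqToIso (by rw [yoneda_id, ps_id_comp]) ≪≫
      yonedaCompIso (F := representable j) (𝟙 j) (R.unit j)
  have e : 𝟙 (R.pt j) ≅ R.counitApp j ≫ R.leg (𝟙 j) :=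
    (inducedPs (R.unit j) (R.pt j)).preimageIso
      (eqToIso (by
        change R.unit j ≫ homIntoPost D (𝟙 _) = R.unit j
        rw [homIntoPost_id, ps_comp_id]) ≪≫ h₂ ≪≫
          eqToIso (R.unit_counitApp_comp (R.leg (𝟙 j))).symm)
  exact ⟨Bicategory.Equivalence.mkOfAdjointifyCounit e (eqToIso h₁), rfl⟩

end DiagramClassifier

end Classifier

/-! ### Strictifying cocones under the classifier of a diagram -/

namespace DiagramClassifier

variable {J : Type u₁} [Bicategory.{w₂, v₂} J] [Bicategory.Strict J]
  {C : Type u₂} [Bicategory.{w₂, v₂} C] [Bicategory.Strict C]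
  {D : StrictPseudofunctor Jᵒᵖ C} (R : DiagramClassifier D)
  {W : StrictPseudofunctor J Cat.{w₂, v₂}} {A : C} (σ : Ps W (homInto D A))

/-- The value at `x` of the strictification of `σ`. -/
noncomputable def strictObj {j : J} (x : W.obj j) : R.pt j ⟶ A :=
  R.desc (yoneda x ≫ σ)

lemma unit_strictObj {j : J} (x : W.obj j) :
    R.unit j ≫ homIntoPost D (R.strictObj σ x) = yoneda x ≫ σ :=
  R.fac _

lemma exists_strictMap {j : J} {x y : W.obj j} (m : x ⟶ y) :
    ∃ β : R.strictObj σ x ⟶ R.strictObj σ y, ∀ {k : J} (h : j ⟶ k),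
      R.leg h ◁ β ≍ (σ.app k).toFunctor.map ((W.map h).toFunctor.map m) :=
  R.exists_hom₂ (R.unit_strictObj σ x) (R.unit_strictObj σ y) (yonedaMap m ▷ σ)

/-- The value at `m` of the strictification of `σ`. -/
noncomputable def strictMap {j : J} {x y : W.obj j} (m : x ⟶ y) :
    R.strictObj σ x ⟶ R.strictObj σ y :=
  (R.exists_strictMap σ m).choose

lemma leg_strictMap {j k : J} {x y : W.obj j} (m : x ⟶ y) (h : j ⟶ k) :
    R.leg h ◁ R.strictMap σ m ≍ (σ.app k).toFunctor.map ((W.map h).toFunctor.map m) :=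
  (R.exists_strictMap σ m).choose_spec h

lemma leg_strictObj {j k : J} (x : W.obj j) (h : j ⟶ k) :
    R.leg h ≫ R.strictObj σ x = (σ.app k).toFunctor.obj ((W.map h).toFunctor.obj x) :=
  R.leg_comp (R.unit_strictObj σ x) h

/-- The components of the strictification of `σ`. -/
noncomputable def strictApp (j : J) : W.obj j ⥤ (homInto R.diagram A).obj j where
  obj x := R.strictObj σ x
  map m := R.strictMap σ m
  map_id x := by
    refine eq_of_heq (R.leg_heq_ext rfl rfl fun h => (R.leg_strictMap σ _ h).trans ?_)
    change _ ≍ R.leg h ◁ 𝟙 (R.strictObj σ x)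
    rw [CategoryTheory.Functor.map_id, CategoryTheory.Functor.map_id, Bicategory.whiskerLeft_id,
      leg_strictObj]
    rfl
  map_comp {x y z} m n := by
    refine eq_of_heq (R.leg_heq_ext rfl rfl fun h => (R.leg_strictMap σ _ h).trans ?_)
    change _ ≍ R.leg h ◁ (R.strictMap σ m ≫ R.strictMap σ n)
    rw [Functor.map_comp, Functor.map_comp, Bicategory.whiskerLeft_comp]
    exact heq_comp (R.leg_strictObj σ x h).symm (R.leg_strictObj σ y h).symm
      (R.leg_strictObj σ z h).symm (R.leg_strictMap σ m h).symm (R.leg_strictMap σ n h).symm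

lemma strictObj_map {i j : J} (f : i ⟶ j) (x : W.obj i) :
    R.strictObj σ ((W.map f).toFunctor.obj x) = R.map f ≫ R.strictObj σ x := by
  apply R.hom_ext
  rw [unit_strictObj, R.unit_map_comp f (R.unit_strictObj σ x), ← ps_assoc, homFromPre_yoneda]

lemma strictMap_map {i j : J} (f : i ⟶ j) {x y : W.obj i} (m : x ⟶ y) :
    R.strictMap σ ((W.map f).toFunctor.map m) ≍ R.map f ◁ R.strictMap σ m := by
  refine R.leg_heq_ext (R.strictObj_map σ f x) (R.strictObj_map σ f y) fun {k} h =>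
    ((R.leg_strictMap σ _ h).trans ?_).trans (R.leg_whiskerLeft_map f h _).symm
  refine HEq.trans ?_ (R.leg_strictMap σ m (f ≫ h)).symm
  refine heq_functor_map _ (obj_comp W f h x).symm (obj_comp W f h y).symm ?_
  rw [map_comp_map]
  exact (heq_conj _ _ _).symm

lemma strictMap_map₂ {i j : J} {f g : i ⟶ j} (α : f ⟶ g) (x : W.obj i) :
    R.strictMap σ ((W.map₂ α).toNatTrans.app x) ≍ R.map₂ α ▷ R.strictObj σ x := by
  refine R.leg_heq_ext (R.strictObj_map σ f x) (R.strictObj_map σ g x) fun {k} h =>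
    ((R.leg_strictMap σ _ h).trans ?_).trans
      (R.leg_map₂_whiskerRight α h (R.unit_strictObj σ x)).symm
  refine heq_functor_map (σ.app k).toFunctor (obj_comp W f h x).symm (obj_comp W g h x).symm ?_
  exact HEq.trans (heq_conj _ _ _).symm (heq_of_eq (map₂_whiskerRight_app W α h x).symm)

/-- The strictification of a pseudonatural `σ : W ⟶ C(D-, A)`: a 2-natural transformation
`W ⟶ C(QD-, A)`. -/
noncomputable def strictification : TwoNat W (homInto R.diagram A) where
  obj := mkTwoNatural (fun j => (R.strictApp σ j).toCatHom)
    (fun f => Cat.ext (CategoryTheory.Functor.hext (R.strictObj_map σ f)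
      (fun _ _ m => R.strictMap_map σ f m)))
    (fun {_ _ f g} α => by
      refine cat_hom₂_ext fun x => (?_ : _ = _).trans (conj_app _ _ _ x).symm
      exact (conj_eqToHom_iff_heq' _ _ (R.strictObj_map σ f x) (R.strictObj_map σ g x).symm).2
        (R.strictMap_map₂ σ α x))
  property _ _ _ := ⟨_, rfl⟩

lemma exists_strictIso {j : J} (x : W.obj j) :
    ∃ e : R.strictObj σ x ≅ R.counitApp j ≫ (σ.app j).toFunctor.obj x,
      ∀ {k : J} (h : j ⟶ k), R.leg h ◁ e.hom ≍ (nat σ h x).hom :=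
  R.exists_iso (R.unit_strictObj σ x) (R.unit_counitApp_comp _) (yonedaCompIso x σ)

/-- The component at `x` of the comparison between `σ` and its strictification: the Yoneda
isomorphism, whose whiskering with the leg at `h` is the structure 2-cell of `σ` at `h`. -/
noncomputable def strictIso {j : J} (x : W.obj j) :
    R.strictObj σ x ≅ R.counitApp j ≫ (σ.app j).toFunctor.obj x :=
  (R.exists_strictIso σ x).choose

lemma leg_strictIso {j k : J} (x : W.obj j) (h : j ⟶ k) :
    R.leg h ◁ (R.strictIso σ x).hom ≍ (nat σ h x).hom :=
  (R.exists_strictIso σ x).choose_spec h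

lemma leg_counitApp_comp {j k : J} (h : j ⟶ k) {A : C} (s : D.obj (op j) ⟶ A) :
    R.leg h ≫ R.counitApp j ≫ s = D.map h.op ≫ s :=
  (Strict.assoc _ _ _).symm.trans (congrArg (· ≫ s) (R.leg_counitApp h))

lemma strictIso_naturality {j : J} {x y : W.obj j} (m : x ⟶ y) :
    R.strictMap σ m ≫ (R.strictIso σ y).hom =
      (R.strictIso σ x).hom ≫ R.counitApp j ◁ (σ.app j).toFunctor.map m := by
  refine eq_of_heq (R.leg_heq_ext rfl rfl fun {k} h => ?_)
  rw [Bicategory.whiskerLeft_comp, Bicategory.whiskerLeft_comp]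
  refine (heq_comp (R.leg_strictObj σ x h) (R.leg_strictObj σ y h) (R.leg_counitApp_comp h _)
    (R.leg_strictMap σ m h) (R.leg_strictIso σ y h)).trans ?_
  refine (heq_of_eq (nat_naturality σ h m)).trans ?_
  exact (heq_comp (R.leg_strictObj σ x h) (R.leg_counitApp_comp h _) (R.leg_counitApp_comp h _)
    (R.leg_strictIso σ x h) (R.leg_whiskerLeft_counitApp h _)).symm

lemma counitApp_map_comp {i j : J} (f : i ⟶ j) {A : C} (s : D.obj (op i) ⟶ A) :
    R.counitApp j ≫ D.map f.op ≫ s = R.map f ≫ R.counitApp i ≫ s :=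
  (Strict.assoc _ _ _).symm.trans
    ((congrArg (· ≫ s) (R.map_counitApp f.op).symm).trans (Strict.assoc _ _ _))

lemma strictIso_map {i j : J} (f : i ⟶ j) (x : W.obj i) :
    (R.strictIso σ ((W.map f).toFunctor.obj x)).hom ≫ R.counitApp j ◁ (nat σ f x).hom ≍
      R.map f ◁ (R.strictIso σ x).hom := by
  refine R.leg_heq_ext (R.strictObj_map σ f x) (R.counitApp_map_comp f _) fun {k} h => ?_
  refine (heq_of_eq (Bicategory.whiskerLeft_comp (R.leg h) _ _)).trans ?_
  refine (heq_comp (R.leg_strictObj σ _ h) (R.leg_counitApp_comp h _) (R.leg_counitApp_comp h _)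
    (R.leg_strictIso σ _ h) (R.leg_whiskerLeft_counitApp h _)).trans ?_
  refine HEq.trans ?_ ((R.leg_whiskerLeft_map f h _).trans (R.leg_strictIso σ x (f ≫ h))).symm
  rw [nat_comp]
  exact (heq_conj_comp _ _ _ _).symm

/-- A pseudonatural `σ : W ⟶ C(D-, A)` becomes 2-natural, up to isomorphism, after
postcomposition with `C(q-, A)`. -/
noncomputable def strictificationIso :
    (R.strictification σ).obj ≅ σ ≫ homIntoMap R.counit A :=
  psIsoMk (fun _ x => R.strictIso σ x) (fun m => R.strictIso_naturality σ m)
    (fun {i j} f x => by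
      rw [(R.strictification σ).property.nat_eq]
      refine eq_of_heq (HEq.trans ?_ (eqToHom_comp_heq _ _).symm)
      refine HEq.trans ?_ (R.strictIso_map σ f x)
      rw [nat_comp_trans, (isTwoNatural_homIntoMap R.counit A).nat_eq]
      exact heq_comp_comp_eqToHom _ _ _)

/-- Every pseudonatural `W ⟶ C(QD-, A)` is isomorphic to a 2-natural one: up to isomorphism it is
`C(q-, A)` after some `σ : W ⟶ C(D-, A)`, since `q` is a pointwise equivalence. -/
lemma essSurj_twoNat_diagram :
    (IsTwoNatural W (homInto R.diagram A)).ι.EssSurj where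
  mem_essImage ρ := by
    have := isEquivalence_postcomp_homIntoMap (W := W) (f := R.counit) R.isEquiv₁_counitApp A
    obtain ⟨σ, ⟨e⟩⟩ := Functor.EssSurj.mem_essImage
      (F := Bicategory.postcomp W.toPseudofunctor (homIntoMap R.counit A)) ρ
    exact ⟨R.strictification σ, ⟨R.strictificationIso σ ≪≫ e⟩⟩

/-- Every weighted colimit of a diagram classifier is a bicolimit: its 2-natural cocones are, up to
isomorphism, all the pseudonatural ones. -/
lemma isBicolimit_diagram (c : WeightedColimit W R.diagram) : IsBicolimit c.cocone.obj := by
  intro A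
  have := (c.isColimit A).isEquivalence
  have := R.essSurj_twoNat_diagram (W := W) (A := A)
  have : (IsTwoNatural W (homInto R.diagram A)).ι.IsEquivalence := { }
  exact inferInstanceAs
    (inducedTwoNat c.cocone A ⋙ (IsTwoNatural W (homInto R.diagram A)).ι).IsEquivalence

end DiagramClassifier

/-! ### Bicolimits and pointwise equivalences of diagrams -/

section Equivalences

variable {J : Type u₁} [Bicategory.{w₂, v₂} J] [Bicategory.Strict J]
  {C : Type u₂} [Bicategory.{w₂, v₂} C] [Bicategory.Strict C]
  {W : StrictPseudofunctor J Cat.{w₂, v₂}} {D E : StrictPseudofunctor Jᵒᵖ C}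

/-- Bicolimits are invariant under pointwise equivalences of diagrams. -/
theorem IsBicolimit.isEquiv₁_mapDiagram {f : TwoNat D E} {c : WeightedColimit W D}
    {c' : WeightedColimit W E} (hc : IsBicolimit c.cocone.obj) (hc' : IsBicolimit c'.cocone.obj)
    (hf : ∀ j : J, IsEquiv₁ (f.obj.app (op j))) :
    IsEquiv₁ (WeightedColimit.mapDiagram f c c') := by
  refine isEquiv₁_of_isEquivalence_precomp fun A => ?_
  have := hc A
  have := hc' A
  have := isEquivalence_postcomp_homIntoMap (W := W) hf A
  have := Functor.isEquivalence_of_iso (WeightedColimit.mapDiagramIso f c c' A).symm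
  exact Functor.isEquivalence_of_comp_right _ (inducedPs c.cocone.obj A)

/-- The bicolimit property is transported along `f` when `W⋆f` is an equivalence. -/
theorem IsBicolimit.of_isEquiv₁_mapDiagram {f : TwoNat D E} {c : WeightedColimit W D}
    {c' : WeightedColimit W E} (hc : IsBicolimit c.cocone.obj)
    (hf : ∀ j : J, IsEquiv₁ (f.obj.app (op j)))
    (h : IsEquiv₁ (WeightedColimit.mapDiagram f c c')) : IsBicolimit c'.cocone.obj := by
  intro A
  have := hc A
  have := h.isEquivalence_precomp A
  have := isEquivalence_postcomp_homIntoMap (W := W) hf A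
  have := Functor.isEquivalence_of_iso (WeightedColimit.mapDiagramIso f c c' A)
  exact Functor.isEquivalence_of_comp_right _
    (Bicategory.postcomp W.toPseudofunctor (homIntoMap f A))

end Equivalences

/-- In a cocomplete 2-category every diagram has a classifier: `QD j` is the colimit of `D`
weighted by the pseudomorphism classifier of `J(j, -)`. -/
noncomputable def IsCocomplete.diagramClassifier {C : Type v} [Bicategory.{u, u} C]
    [Bicategory.Strict C] (hcolim : IsCocomplete C) {J : Type u} [Bicategory.{u, u} J]
    [Bicategory.Strict J] (D : StrictPseudofunctor Jᵒᵖ C) : DiagramClassifier D where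
  pt j := (hcolim J (classifier (representable j)).obj D).some.pt
  unit j := (classifier (representable j)).unit ≫
    (hcolim J (classifier (representable j)).obj D).some.cocone.obj
  universal j A := isIsoOfCategories_inducedPs_unit (classifier (representable j)) _ A

end TwoCat

theorem mainTheorem5 {C : Type v} [Bicategory.{u, u} C] [Bicategory.Strict C]
    (hlim : TwoCat.IsComplete C) (hcolim : TwoCat.IsCocomplete C)
    {J : Type u} [Bicategory.{u, u} J] [Bicategory.Strict J]
    (W : StrictPseudofunctor J Cat.{u, u}) :
    List.TFAE [
      ∀ (D : StrictPseudofunctor Jᵒᵖ C) (c : TwoCat.WeightedColimit W D),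
        TwoCat.IsBicolimit c.cocone.obj,
      ∀ (K : TwoCat.PseudomorphismClassifier W) (D : StrictPseudofunctor Jᵒᵖ C)
        (c : TwoCat.WeightedColimit K.obj D) (c' : TwoCat.WeightedColimit W D),
        TwoCat.IsEquiv₁ (TwoCat.WeightedColimit.mapWeight K.counit c c'),
      ∀ (D E : StrictPseudofunctor Jᵒᵖ C) (f : TwoCat.TwoNat D E)
        (c : TwoCat.WeightedColimit W D) (c' : TwoCat.WeightedColimit W E),
        (∀ j : J, TwoCat.IsEquiv₁ (f.obj.app (op j))) →
          TwoCat.IsEquiv₁ (TwoCat.WeightedColimit.mapDiagram f c c')] := by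
  tfae_have 1 → 2 := fun h K D c c' =>
    (TwoCat.isBicolimit_iff_isEquiv₁_mapWeight_counit K c c').1 (h D c')
  tfae_have 2 → 1 := fun h D c' =>
    have K := TwoCat.classifier W
    have c : TwoCat.WeightedColimit K.obj D := (hcolim J K.obj D).some
    (TwoCat.isBicolimit_iff_isEquiv₁_mapWeight_counit K c c').2 (h K D c c')
  tfae_have 1 → 3 := fun h D E f c c' hf => (h D c).isEquiv₁_mapDiagram (h E c') hf
  tfae_have 3 → 1 := fun h D c' =>
    -- `W⋆QD` is always a bicolimit, and the pointwise equivalence `q : QD ⟶ D` carries this to `W⋆D`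
    have R := hcolim.diagramClassifier D
    have c : TwoCat.WeightedColimit W R.diagram := (hcolim J W R.diagram).some
    TwoCat.IsBicolimit.of_isEquiv₁_mapDiagram (R.isBicolimit_diagram c) R.isEquiv₁_counitApp
      (h R.diagram D R.counit c c' R.isEquiv₁_counitApp)
  tfae_finish
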